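/- **Setting.** Let $l\ge 1$ and let $y(t)\in\mathbb R^p$, $u(t)\in\mathbb R^m$, $w(t)\in\mathbb R^{m_w}$ ($-l\le t\le N-1$) be recorded signals. Put $$\chi(t)=\mathrm{col}\big(y(t-1),\dots,y(t-l),\,u(t-1),\dots,u(t-l),\,w(t-1),\dots,w(t-l)\big),$$ $Y=(y(0)\cdots y(N-1))$, $X=(\chi(0)\cdots\chi(N-1))$, $U_0=(u(0)\cdots u(N-1))$, $W=(w(0)\cdots w(N-1))$. Let $J_A,J_B,J_{B_1}$ be the constant 0/1 shift matrices for which, for all signals, $\chi(t+1)=\mathrm{col}\big(y(t),\,J_A\chi(t)+J_Bu(t)+J_{B_1}w(t)\big)$. Let $X=X_s\Sigma_\chi X_r^\top$ be a compact singular value decomposition with $X_s$ having $\tilde n$ columns, and $X_d=\Sigma_\chi X_r^\top$. Let $B_{d0}\in\mathbb R^{p\times m_d}$ have full column rank, and let $\Phi=\Phi^\top=\begin{pmatrix}\Phi_{11}&\Phi_{12}\\ \Phi_{12}^\top&\Phi_{22}\end{pmatrix}\in\mathbb R^{(m_d+N)\times(m_d+N)}$ with $\Phi_{22}\prec0$.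 Let $\Sigma$ be the set of all triples $(\bar A_s,B_{u0},B_{w0})\in\mathbb R^{p\times\tilde n}\times\mathbb R^{p\times m}\times\mathbb R^{p\times m_w}$ such that $$Y=\bar A_sX_d+B_{u0}U_0+B_{w0}W+B_{d0}W_d\quad\text{for some }W_d\text{ with}\quad \begin{pmatrix}I\\W_d^\top\end{pmatrix}^{\!\top}\Phi\begin{pmatrix}I\\W_d^\top\end{pmatrix}\succeq0 .$$ Assume that the first $p$ rows of $X$ are linearly independent, that $\Sigma\ne\emptyset$, and that $\mathrm{rank}\,\mathrm{col}(X_d,U_0,W)=\tilde n+m+m_w$. **Closed loop.** Let $\hat C_1,E,D_1,\hat C$ be given matrices of compatible sizes ($z=\hat C_1\chi+Eu+D_1w\in\mathbb R^{p_z}$, $y_c=\hat C\chi$), $C_1=\hat C_1X_s$, $C=\hat CX_s$. For a triple $(\bar A_s,B_{u0},B_{w0})$ put $$A=X_s^\top\begin{pmatrix}\bar A_s\\J_AX_s\end{pmatrix},\quad B=X_s^\top\begin{pmatrix}B_{u0}\\J_B\end{pmatrix},\quad B_1=X_s^\top\begin{pmatrix}B_{w0}\\J_{B_1}\end{pmatrix},$$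 and for a controller $(A_c,B_c,C_c,D_c)$ of order $\tilde n$ $$\tilde A=\begin{pmatrix}A+BD_cC&BC_c\\B_cC&A_c\end{pmatrix},\quad \tilde B=\begin{pmatrix}B_1\\0\end{pmatrix},\quad \tilde C=\begin{pmatrix}C_1+ED_cC&EC_c\end{pmatrix},\quad \tilde D=D_1 .$$ **Auxiliary matrices.** Let $H=G\Phi G^\top$ with $G=\begin{pmatrix}B_{d0}&Y\\0&-\mathrm{col}(X_d,U_0,W)\end{pmatrix}$, partitioned as $H=(H_{ij})_{i,j=1}^4$ with block sizes $p,\tilde n,m,m_w$; write $H_\circ=(H_{ij})_{i,j=2}^4$ and $h=(H_{12}\ H_{13}\ H_{14})$. Put $(\check A_s\ \check B_{u0}\ \check B_{w0})^\top=-H_\circ^{-1}h^\top$, let $\check A,\check B,\check B_1$ be the matrices $A,B,B_1$ of the triple $(\check A_s,\check B_{u0},\check B_{w0})$, and let $\bar h^\top=h^\top+H_\circ(\check A_s\ \check B_{u0}\ \check B_{w0})^\top$. Let $\Lambda\in\mathbb R^{\tilde p\times\tilde p}$, $\Lambda\succ0$, and $\Xi\in\mathbb R^{p\times\tilde p}$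 be any matrices with $$(I\ \check A_s\ \check B_{u0}\ \check B_{w0})\,H\,(I\ \check A_s\ \check B_{u0}\ \check B_{w0})^\top=\Xi\Lambda\Xi^\top .$$ Let $X_{s1}$ consist of the first $p$ rows of $X_s$, let $L_1\in\mathbb R^{(\tilde n-p)\times\tilde n}$ be any matrix whose rows form a basis of $\ker X_{s1}$, and $L=\mathrm{col}\big(L_1,(X_{s1}X_{s1}^\top)^{-1}X_{s1}\big)$. For a scalar $\alpha$ and matrices $\bar X,\bar Y,\tilde A_c,\tilde B_c,\tilde C_c,D_c$ let $$\Pi=\begin{pmatrix}\Pi_{11}&\Pi_{12}\\\Pi_{12}^\top&\Pi_{22}\end{pmatrix},\qquad \Pi_{11}=\begin{pmatrix}\bar X&I&0\\I&\bar Y&0\\0&0&I_{m_w}\end{pmatrix},\qquad \Pi_{12}^\top=\begin{pmatrix}\check A+\check BD_cC&\check A\bar Y+\check B\tilde C_c&\check B_1\\ \bar X\check A+\tilde B_cC&\tilde A_c&\bar X\check B_1\\ I&\bar Y&0\\ D_cC&\tilde C_c&0\\0&0&I_{m_w}\\0_{\tilde p\times\tilde n}&0&0\end{pmatrix},$$ $$\Pi_{22}=\begin{pmatrix}\bar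 Y&I&\star&\star\\ I&\bar X&\star&\star\\ (0\ \ {-\alpha}\bar h^\top)L^{-\top}&(0\ \ {-\alpha}\bar h^\top)L^{-\top}\bar X&-\alpha H_\circ&\star\\ (0\ \ \alpha\Xi^\top)L^{-\top}&(0\ \ \alpha\Xi^\top)L^{-\top}\bar X&0&\alpha\Lambda^{-1}\end{pmatrix},\qquad \Delta=\begin{pmatrix}I&D_1^\top&0&0\\ \star&Z&C_1+ED_cC&C_1\bar Y+E\tilde C_c\\ \star&\star&\bar X&I\\ \star&\star&\star&\bar Y\end{pmatrix},$$ where $\star$ denotes blocks determined by symmetry. **Theorem.** Let $\mu\in\mathbb R$ and $Z\in\mathbb R^{p_z\times p_z}$. The following are equivalent: (i) there are a controller $(A_c,B_c,C_c,D_c)$ of order $\tilde n$ and a matrix $P$ such that for all $(\bar A_s,B_{u0},B_{w0})\in\Sigma$ $$\mathrm{tr}(Z)<\mu^2,\qquad \begin{pmatrix}I&\tilde B^\top\\ \tilde B&P-\tilde AP\tilde A^\top\end{pmatrix}\succ0,\qquad \begin{pmatrix}Z-\tilde D\tilde D^\top&\tilde CP\\P\tilde C^\top&P\end{pmatrix}\succ0;$$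 (ii) $\mathrm{tr}(Z)<\mu^2$, $\Pi\succ0$ and $\Delta\succ0$ for some real scalar $\alpha$, symmetric matrices $\bar X,\bar Y$ and matrices $\tilde A_c,\tilde B_c,\tilde C_c,D_c$. Furthermore, for every solution of (ii) and every full-rank (i.e. invertible) $V\in\mathbb R^{\tilde n\times\tilde n}$, the matrix $U=(I-\bar X\bar Y)V^{-\top}$ is invertible, and the controller consisting of $D_c$ and $$B_c=U^{-1}(\tilde B_c-\bar X\check BD_c),\quad C_c=(\tilde C_c-D_cC\bar Y)V^{-\top},\quad A_c=U^{-1}\big(\tilde A_c-\bar X(\check A\bar Y+\check B\tilde C_c)-UB_cC\bar Y\big)V^{-\top}$$ satisfies the inequalities in (i), for all triples in $\Sigma$, with some matrix $P$. -/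

import Mathlib

open Matrix

noncomputable section

namespace DataDrivenH2

/-- Index set of all entries of the extended state `χ(t)` except the first block `y(t-1)`:
`y(t-2),…,y(t-l)`, then `u(t-1),…,u(t-l)`, then `w(t-1),…,w(t-l)`, where the lag is `l = k+1`. -/
abbrev RestIdx (k p m mw : ℕ) : Type :=
  (Fin k × Fin p) ⊕ (Fin (k + 1) × Fin m) ⊕ (Fin (k + 1) × Fin mw)

/-- Index set of the extended state `χ(t)`; the first summand is the block `y(t-1)`. -/
abbrev StateIdx (k p m mw : ℕ) : Type := Fin p ⊕ RestIdx k p m mw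

section Realization

variable {k p m mw : ℕ}

/-- Position of `y_i(t-1-j)` in `χ(t)`, for `j = 0,…,l-1`. -/
def yPos (j : Fin (k + 1)) (i : Fin p) : StateIdx k p m mw :=
  Fin.cases (Sum.inl i) (fun j' => Sum.inr (Sum.inl (j', i))) j

/-- Position of `u_i(t-1-j)` in `χ(t)`. -/
def uPos (j : Fin (k + 1)) (i : Fin m) : StateIdx k p m mw := Sum.inr (Sum.inr (Sum.inl (j, i)))

/-- Position of `w_i(t-1-j)` in `χ(t)`. -/
def wPos (j : Fin (k + 1)) (i : Fin mw) : StateIdx k p m mw := Sum.inr (Sum.inr (Sum.inr (j, i)))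

/-- The extended state `χ(t)`: the last `l = k+1` values of `y`, `u` and `w` before time `t`. -/
def chi (y : ℤ → Fin p → ℝ) (u : ℤ → Fin m → ℝ) (w : ℤ → Fin mw → ℝ) (t : ℤ) :
    StateIdx k p m mw → ℝ
  | Sum.inl i => y (t - 1) i
  | Sum.inr (Sum.inl (j, i)) => y (t - 2 - (j : ℕ)) i
  | Sum.inr (Sum.inr (Sum.inl (j, i))) => u (t - 1 - (j : ℕ)) i
  | Sum.inr (Sum.inr (Sum.inr (j, i))) => w (t - 1 - (j : ℕ)) i

/-- The shift matrix `J_A`. -/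
def JA : Matrix (RestIdx k p m mw) (StateIdx k p m mw) ℝ := Matrix.of fun r c =>
  match r with
  | Sum.inl (j, i) => if c = yPos j.castSucc i then 1 else 0
  | Sum.inr (Sum.inl (j, i)) =>
      Fin.cases (0 : ℝ) (fun j' => if c = uPos j'.castSucc i then 1 else 0) j
  | Sum.inr (Sum.inr (j, i)) =>
      Fin.cases (0 : ℝ) (fun j' => if c = wPos j'.castSucc i then 1 else 0) j

/-- The matrix `J_B`: the input `u(t)` enters the block of `χ(t+1)` holding `u(t)`. -/
def JB : Matrix (RestIdx k p m mw) (Fin m) ℝ := Matrix.of fun r c =>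
  match r with
  | Sum.inr (Sum.inl (j, i)) => if j = 0 ∧ i = c then 1 else 0
  | _ => 0

/-- The matrix `J_{B_1}`: the input `w(t)` enters the block of `χ(t+1)` holding `w(t)`. -/
def JB1 : Matrix (RestIdx k p m mw) (Fin mw) ℝ := Matrix.of fun r c =>
  match r with
  | Sum.inr (Sum.inr (j, i)) => if j = 0 ∧ i = c then 1 else 0
  | _ => 0

end Realization

/-- Inverse of an invertible matrix whose rows and columns are labelled by different index sets. -/
def rectInv {a b : Type*} [Fintype a] [Fintype b] [DecidableEq b] (M : Matrix a b ℝ) :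
    Matrix b a ℝ := (Mᵀ * M)⁻¹ * Mᵀ

/-- `rectInv` is the two-sided inverse whenever there is one. -/
theorem rectInv_eq {a b : Type*} [Fintype a] [Fintype b] [DecidableEq a] [DecidableEq b]
    (M : Matrix a b ℝ) (R : Matrix b a ℝ) (h1 : M * R = 1) (h2 : R * M = 1) :
    rectInv M = R := by
  have h3 : (Mᵀ * M) * (R * Rᵀ) = 1 := by
    rw [Matrix.mul_assoc, ← Matrix.mul_assoc M, h1, Matrix.one_mul, ← Matrix.transpose_mul, h2,
      Matrix.transpose_one]
  rw [rectInv, Matrix.inv_eq_right_inv h3, Matrix.mul_assoc, ← Matrix.transpose_mul, h1,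
    Matrix.transpose_one, Matrix.mul_one]

/-- The objects that are known or chosen by the designer. Dimensions: lag `l = k+1`, output `p`,
control input `m`, performance input `mw`, noise `md`, number `N` of data columns, controlled
output `pz`, controller input `pc`, rank `n` of the state data matrix, size `q` of the factor `Λ`.
Only data fields; all requirements on them are hypotheses of the theorem. -/
structure Setup (k p m mw md N pz pc n q : ℕ) where
  /-- recorded output; only the times `-l,…,N-1` matter -/
  y : ℤ → Fin p → ℝ
  /-- recorded control input -/
  u : ℤ → Fin m → ℝ
  /-- recorded performance input -/
  w : ℤ → Fin mw → ℝ
  /-- noise input matrix `B_{d0}` -/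
  Bd0 : Matrix (Fin p) (Fin md) ℝ
  /-- noise bound -/
  Φ : Matrix (Fin md ⊕ Fin N) (Fin md ⊕ Fin N) ℝ
  /-- `Ĉ₁`, with `z = Ĉ₁ χ + E u + D₁ w` -/
  C1hat : Matrix (Fin pz) (StateIdx k p m mw) ℝ
  E : Matrix (Fin pz) (Fin m) ℝ
  D1 : Matrix (Fin pz) (Fin mw) ℝ
  /-- `Ĉ`, with controller input `y_c = Ĉ χ` -/
  Chat : Matrix (Fin pc) (StateIdx k p m mw) ℝ
  /-- left factor of the compact singular value decomposition of the state data -/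
  Xs : Matrix (StateIdx k p m mw) (Fin n) ℝ
  /-- the nonzero singular values -/
  sv : Fin n → ℝ
  /-- right factor of the compact singular value decomposition -/
  Xr : Matrix (Fin N) (Fin n) ℝ
  L1 : Matrix (Fin (n - p)) (Fin n) ℝ
  Ξ : Matrix (Fin p) (Fin q) ℝ
  Λ : Matrix (Fin q) (Fin q) ℝ

/-- Dynamic output-feedback controller of order `n`. -/
structure Controller (m pc n : ℕ) where
  Ac : Matrix (Fin n) (Fin n) ℝ
  Bc : Matrix (Fin n) (Fin pc) ℝ
  Cc : Matrix (Fin m) (Fin n) ℝ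
  Dc : Matrix (Fin m) (Fin pc) ℝ

/-- Decision variables of the synthesis inequalities:
`α`, `X̄`, `Ȳ`, `Ã_c`, `B̃_c`, `C̃_c`, `D_c`. -/
structure DecisionVars (m pc n : ℕ) where
  α : ℝ
  Xb : Matrix (Fin n) (Fin n) ℝ
  Yb : Matrix (Fin n) (Fin n) ℝ
  At : Matrix (Fin n) (Fin n) ℝ
  Bt : Matrix (Fin n) (Fin pc) ℝ
  Ct : Matrix (Fin m) (Fin n) ℝ
  Dc : Matrix (Fin m) (Fin pc) ℝ

namespace Setup

variable {k p m mw md N pz pc n q : ℕ} (S : Setup k p m mw md N pz pc n q)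

/-! ### Data matrices -/

/-- `Y = (y(0) ⋯ y(N-1))`. -/
def Y : Matrix (Fin p) (Fin N) ℝ := Matrix.of fun i t => S.y (t : ℕ) i

/-- `X = (χ(0) ⋯ χ(N-1))`. -/
def X : Matrix (StateIdx k p m mw) (Fin N) ℝ := Matrix.of fun i t => chi S.y S.u S.w (t : ℕ) i

/-- `U = (u(0) ⋯ u(N-1))`. -/
def U : Matrix (Fin m) (Fin N) ℝ := Matrix.of fun i t => S.u (t : ℕ) i

/-- `W = (w(0) ⋯ w(N-1))`. -/
def W : Matrix (Fin mw) (Fin N) ℝ := Matrix.of fun i t => S.w (t : ℕ) i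

/-- `X = X_s diag(σ) X_rᵀ` is a compact singular value decomposition. -/
def IsCompactSVD : Prop :=
  S.X = S.Xs * Matrix.diagonal S.sv * S.Xrᵀ ∧ S.Xsᵀ * S.Xs = 1 ∧ S.Xrᵀ * S.Xr = 1 ∧
    ∀ i, 0 < S.sv i

/-- `X_d`. -/
def Xd : Matrix (Fin n) (Fin N) ℝ := Matrix.diagonal S.sv * S.Xrᵀ

/-- `col(X_d, U, W)`. -/
def regressor : Matrix (Fin n ⊕ Fin m ⊕ Fin mw) (Fin N) ℝ := fromRows S.Xd (fromRows S.U S.W)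

/-! ### Plants consistent with the data -/

/-- `col(I, W_dᵀ)`. -/
def noiseCol (Wd : Matrix (Fin md) (Fin N) ℝ) : Matrix (Fin md ⊕ Fin N) (Fin md) ℝ :=
  fromRows 1 Wdᵀ

/-- The quadratic matrix inequality bounding the noise data `W_d`. -/
def NoiseBound (Wd : Matrix (Fin md) (Fin N) ℝ) : Prop :=
  ((noiseCol Wd)ᵀ * S.Φ * noiseCol Wd).PosSemidef

/-- The set `Σ` of the triples `(Ā_s, B_{u0}, B_{w0})` that explain the data. -/
def Sigma : Set (Matrix (Fin p) (Fin n) ℝ × Matrix (Fin p) (Fin m) ℝ × Matrix (Fin p) (Fin mw) ℝ) :=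
  {T | ∃ Wd : Matrix (Fin md) (Fin N) ℝ, S.NoiseBound Wd ∧
    S.Y = T.1 * S.Xd + T.2.1 * S.U + T.2.2 * S.W + S.Bd0 * Wd}

/-! ### Reduced realization and closed loop -/

/-- `A = X_sᵀ Â X_s` with `Â X_s = col(Ā_s, J_A X_s)`, as a function of `Ā_s`. -/
def A (As : Matrix (Fin p) (Fin n) ℝ) : Matrix (Fin n) (Fin n) ℝ :=
  S.Xsᵀ * fromRows As (JA * S.Xs)

/-- `B = X_sᵀ B̂` with `B̂ = col(B_{u0}, J_B)`. -/
def B (Bu : Matrix (Fin p) (Fin m) ℝ) : Matrix (Fin n) (Fin m) ℝ := S.Xsᵀ * fromRows Bu JB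

/-- `B₁ = X_sᵀ B̂₁` with `B̂₁ = col(B_{w0}, J_{B_1})`. -/
def B1 (Bw : Matrix (Fin p) (Fin mw) ℝ) : Matrix (Fin n) (Fin mw) ℝ := S.Xsᵀ * fromRows Bw JB1

/-- `C₁ = Ĉ₁ X_s`. -/
def C1 : Matrix (Fin pz) (Fin n) ℝ := S.C1hat * S.Xs

/-- `C = Ĉ X_s`. -/
def C : Matrix (Fin pc) (Fin n) ℝ := S.Chat * S.Xs

/-- The closed-loop matrix `Ã`. -/
def clA (K : Controller m pc n) (As : Matrix (Fin p) (Fin n) ℝ) (Bu : Matrix (Fin p) (Fin m) ℝ) :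
    Matrix (Fin n ⊕ Fin n) (Fin n ⊕ Fin n) ℝ :=
  fromBlocks (S.A As + S.B Bu * K.Dc * S.C) (S.B Bu * K.Cc) (K.Bc * S.C) K.Ac

/-- The closed-loop matrix `B̃`. -/
def clB (Bw : Matrix (Fin p) (Fin mw) ℝ) : Matrix (Fin n ⊕ Fin n) (Fin mw) ℝ :=
  fromRows (S.B1 Bw) 0

/-- The closed-loop matrix `C̃`. -/
def clC (K : Controller m pc n) : Matrix (Fin pz) (Fin n ⊕ Fin n) ℝ :=
  fromCols (S.C1 + S.E * K.Dc * S.C) (S.E * K.Cc)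

/-- The closed-loop matrix `D̃`. -/
def clD : Matrix (Fin pz) (Fin mw) ℝ := S.D1

/-- The `H₂` inequalities for the closed loop of the controller `K`, with the certificates `P` and
`Z` common to all triples in `Σ`. -/
def H2Robust (μ : ℝ) (Z : Matrix (Fin pz) (Fin pz) ℝ) (K : Controller m pc n)
    (P : Matrix (Fin n ⊕ Fin n) (Fin n ⊕ Fin n) ℝ) : Prop :=
  ∀ As Bu Bw, (As, Bu, Bw) ∈ S.Sigma →
    Z.trace < μ ^ 2 ∧
    (fromBlocks (1 : Matrix (Fin mw) (Fin mw) ℝ) (S.clB Bw)ᵀ (S.clB Bw)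
      (P - S.clA K As Bu * P * (S.clA K As Bu)ᵀ)).PosDef ∧
    (fromBlocks (Z - S.clD * S.clDᵀ) (S.clC K * P) (P * (S.clC K)ᵀ) P).PosDef

/-! ### Auxiliary matrices -/

/-- The outer factor `(B_{d0} Y; 0 -col(X_d, U, W))` of `H`. -/
def Hfac : Matrix (Fin p ⊕ (Fin n ⊕ Fin m ⊕ Fin mw)) (Fin md ⊕ Fin N) ℝ :=
  fromBlocks S.Bd0 S.Y 0 (-S.regressor)

/-- The matrix `H` describing `Σ`. -/
def H : Matrix (Fin p ⊕ (Fin n ⊕ Fin m ⊕ Fin mw)) (Fin p ⊕ (Fin n ⊕ Fin m ⊕ Fin mw)) ℝ :=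
  S.Hfac * S.Φ * S.Hfacᵀ

/-- The block row `(H₁₂ H₁₃ H₁₄)`. -/
def Htop : Matrix (Fin p) (Fin n ⊕ Fin m ⊕ Fin mw) ℝ := S.H.toBlocks₁₂

/-- The lower right `3 × 3` block part of `H`. -/
def Hlow : Matrix (Fin n ⊕ Fin m ⊕ Fin mw) (Fin n ⊕ Fin m ⊕ Fin mw) ℝ := S.H.toBlocks₂₂

/-- `(Ǎ_s B̌_{u0} B̌_{w0})ᵀ`. -/
def checkT : Matrix (Fin n ⊕ Fin m ⊕ Fin mw) (Fin p) ℝ := -(S.Hlow⁻¹ * S.Htopᵀ)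

/-- `Ǎ_s`. -/
def checkAs : Matrix (Fin p) (Fin n) ℝ := S.checkT.toRows₁ᵀ

/-- `B̌_{u0}`. -/
def checkBu : Matrix (Fin p) (Fin m) ℝ := S.checkT.toRows₂.toRows₁ᵀ

/-- `B̌_{w0}`. -/
def checkBw : Matrix (Fin p) (Fin mw) ℝ := S.checkT.toRows₂.toRows₂ᵀ

/-- `col(I, Ǎ_sᵀ, B̌_{u0}ᵀ, B̌_{w0}ᵀ)`. -/
def checkCol : Matrix (Fin p ⊕ (Fin n ⊕ Fin m ⊕ Fin mw)) (Fin p) ℝ := fromRows 1 S.checkT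

/-- `Λ ≻ 0` and `Ξ Λ Ξᵀ` factorizes
`(I Ǎ_s B̌_{u0} B̌_{w0}) H (I Ǎ_s B̌_{u0} B̌_{w0})ᵀ`. -/
def IsFactorization : Prop :=
  S.Λ.PosDef ∧ S.checkColᵀ * S.H * S.checkCol = S.Ξ * S.Λ * S.Ξᵀ

/-- `Ǎ`. -/
def checkA : Matrix (Fin n) (Fin n) ℝ := S.A S.checkAs

/-- `B̌`. -/
def checkB : Matrix (Fin n) (Fin m) ℝ := S.B S.checkBu

/-- `B̌₁`. -/
def checkB1 : Matrix (Fin n) (Fin mw) ℝ := S.B1 S.checkBw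

/-- `col(H̄₁₂ᵀ, H̄₁₃ᵀ, H̄₁₄ᵀ)`. -/
def HbarT : Matrix (Fin n ⊕ Fin m ⊕ Fin mw) (Fin p) ℝ :=
  (fromCols S.Htopᵀ S.Hlow : Matrix _ (Fin p ⊕ (Fin n ⊕ Fin m ⊕ Fin mw)) ℝ) * S.checkCol

/-- `X_{s1}`, the first `p` rows of `X_s`. -/
def Xs1 : Matrix (Fin p) (Fin n) ℝ := S.Xs.toRows₁

/-- The columns of `L₁ᵀ` (the rows of `L₁`) form a basis of `ker X_{s1}`. -/
def IsKernelBasis : Prop :=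
  LinearIndependent ℝ (fun i => S.L1 i) ∧
    Submodule.span ℝ (Set.range fun i => S.L1 i) = LinearMap.ker S.Xs1.mulVecLin

/-- `L = col(L₁, L₂)` with `L₂ = (X_{s1} X_{s1}ᵀ)⁻¹ X_{s1}`. -/
def L : Matrix (Fin (n - p) ⊕ Fin p) (Fin n) ℝ := fromRows S.L1 ((S.Xs1 * S.Xs1ᵀ)⁻¹ * S.Xs1)

/-- `L^{-ᵀ}`. -/
def LinvT : Matrix (Fin (n - p) ⊕ Fin p) (Fin n) ℝ := (rectInv S.L)ᵀ

/-! ### The synthesis inequalities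

`Π` is written for `Q = -I`, `S = 0` and an empty `R̃` block. -/

variable (v : DecisionVars m pc n)

/-- `Π₁₁`. -/
def Pi11 : Matrix ((Fin n ⊕ Fin n) ⊕ Fin mw) ((Fin n ⊕ Fin n) ⊕ Fin mw) ℝ :=
  fromBlocks (fromBlocks v.Xb 1 1 v.Yb) 0 0 1

/-- `Π₁₂ᵀ`; block rows `n, n, (n, m, mw), q`, block columns `n, n, mw`. -/
def Pi12T : Matrix ((Fin n ⊕ Fin n) ⊕ ((Fin n ⊕ Fin m ⊕ Fin mw) ⊕ Fin q))
    ((Fin n ⊕ Fin n) ⊕ Fin mw) ℝ :=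
  fromRows
    (fromCols
      (fromBlocks
        (S.checkA + S.checkB * v.Dc * S.C) (S.checkA * v.Yb + S.checkB * v.Ct)
        (v.Xb * S.checkA + v.Bt * S.C) v.At)
      (fromRows S.checkB1 (v.Xb * S.checkB1)))
    (fromRows
      (fromRows (fromCols (fromCols 1 v.Yb) 0)
        (fromRows (fromCols (fromCols (v.Dc * S.C) v.Ct) 0) (fromCols 0 1)))
      0)

/-- `(0 M) L^{-ᵀ}` for a matrix `M` with `p` columns. -/
def padL {b : Type} (M : Matrix b (Fin p) ℝ) : Matrix b (Fin n) ℝ :=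
  (fromCols 0 M : Matrix b (Fin (n - p) ⊕ Fin p) ℝ) * S.LinvT

/-- The block rows of `Π₂₂` below its upper left `2n × 2n` corner `(Ȳ I; I X̄)`, restricted to the
columns of that corner. -/
def Pi22low : Matrix ((Fin n ⊕ Fin m ⊕ Fin mw) ⊕ Fin q) (Fin n ⊕ Fin n) ℝ :=
  fromRows
    (fromCols (S.padL (-(v.α • S.HbarT))) (S.padL (-(v.α • S.HbarT)) * v.Xb))
    (fromCols (S.padL (v.α • S.Ξᵀ)) (S.padL (v.α • S.Ξᵀ) * v.Xb))

/-- `Π₂₂`. -/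
def Pi22 : Matrix ((Fin n ⊕ Fin n) ⊕ ((Fin n ⊕ Fin m ⊕ Fin mw) ⊕ Fin q))
    ((Fin n ⊕ Fin n) ⊕ ((Fin n ⊕ Fin m ⊕ Fin mw) ⊕ Fin q)) ℝ :=
  fromBlocks (fromBlocks v.Yb 1 1 v.Xb) (S.Pi22low v)ᵀ (S.Pi22low v)
    (fromBlocks (-(v.α • S.Hlow)) 0 0 (v.α • S.Λ⁻¹))

/-- `Π`. -/
def PiMat : Matrix
    (((Fin n ⊕ Fin n) ⊕ Fin mw) ⊕ ((Fin n ⊕ Fin n) ⊕ ((Fin n ⊕ Fin m ⊕ Fin mw) ⊕ Fin q)))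
    (((Fin n ⊕ Fin n) ⊕ Fin mw) ⊕ ((Fin n ⊕ Fin n) ⊕ ((Fin n ⊕ Fin m ⊕ Fin mw) ⊕ Fin q))) ℝ :=
  fromBlocks (Pi11 v) (S.Pi12T v)ᵀ (S.Pi12T v) (S.Pi22 v)

/-- `Δ`; block rows and columns `mw, pz, n, n`. -/
def DeltaMat (Z : Matrix (Fin pz) (Fin pz) ℝ) :
    Matrix ((Fin mw ⊕ Fin pz) ⊕ (Fin n ⊕ Fin n)) ((Fin mw ⊕ Fin pz) ⊕ (Fin n ⊕ Fin n)) ℝ :=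
  fromBlocks
    (fromBlocks 1 S.D1ᵀ S.D1 Z)
    (fromRows 0 (fromCols (S.C1 + S.E * v.Dc * S.C) (S.C1 * v.Yb + S.E * v.Ct)))
    (fromRows 0 (fromCols (S.C1 + S.E * v.Dc * S.C) (S.C1 * v.Yb + S.E * v.Ct)))ᵀ
    (fromBlocks v.Xb 1 1 v.Yb)

/-- The synthesis inequalities hold for the decision variables `v`. -/
def SynthesisLMI (μ : ℝ) (Z : Matrix (Fin pz) (Fin pz) ℝ) : Prop :=
  v.Xb.IsSymm ∧ v.Yb.IsSymm ∧
    Z.trace < μ ^ 2 ∧ (S.PiMat v).PosDef ∧ (S.DeltaMat v Z).PosDef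

/-! ### Reconstruction of the controller -/

/-- The matrix `U = (I - X̄ Ȳ) V^{-ᵀ}`. -/
def recU (V : Matrix (Fin n) (Fin n) ℝ) : Matrix (Fin n) (Fin n) ℝ := (1 - v.Xb * v.Yb) * Vᵀ⁻¹

/-- `B_c`. -/
def recB (V : Matrix (Fin n) (Fin n) ℝ) : Matrix (Fin n) (Fin pc) ℝ :=
  (recU v V)⁻¹ * (v.Bt - v.Xb * S.checkB * v.Dc)

/-- The controller reconstructed from the decision variables and `V`. -/
def reconstruct (V : Matrix (Fin n) (Fin n) ℝ) : Controller m pc n where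
  Ac := (recU v V)⁻¹ * (v.At - v.Xb * (S.checkA * v.Yb + S.checkB * v.Ct)
    - recU v V * S.recB v V * S.C * v.Yb) * Vᵀ⁻¹
  Bc := S.recB v V
  Cc := (v.Ct - v.Dc * S.C * v.Yb) * Vᵀ⁻¹
  Dc := v.Dc

end Setup

end DataDrivenH2

end

/-
The triples in `Σ` form a matrix ellipsoid: eliminating `W_d` and completing the square turns the
noise bound into `D (-H_∘) Dᵀ ⪯ Ξ Λ Ξᵀ` for the deviation `D` from the centre
`(Ǎ_s, B̌_{u0}, B̌_{w0})`. A vector pair `(η, ξ)` satisfies `ξ = Dᵀ η` for some `D` in the ellipsoid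
exactly if `ξᵀ (-H_∘) ξ ≤ ηᵀ Ξ Λ Ξᵀ η`, since a rank-one `D` suffices. The closed loop is affine in
`D`, so requiring the Lyapunov inequality on the ellipsoid is a single implication between two
quadratic inequalities, and the strict S-lemma makes it equivalent to the existence of one
multiplier `α`. Both `H₂` inequalities being open in `P`, the off-diagonal block of `P` may be
assumed invertible, and the linearizing congruence with `(X̄ I; Uᵀ 0)` turns them into `Π ≻ 0` and
`Δ ≻ 0`. Given a solution of these, the same congruence, read backwards, defines `P`.
-/

namespace DataDrivenH2

section SLemma

open scoped Topology

theorem quadraticForm_map_smul_add_smul {R M : Type*} [CommRing R] [AddCommGroup M] [Module R M]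
    (Q : QuadraticForm R M) (a b : R) (x y : M) :
    Q (a • x + b • y) = a ^ 2 * Q x + a * b * QuadraticMap.polar Q x y + b ^ 2 * Q y := by
  rw [QuadraticMap.map_add Q, QuadraticMap.map_smul, QuadraticMap.map_smul,
    QuadraticMap.polar_smul_left, QuadraticMap.polar_smul_right]
  simp only [smul_eq_mul]
  ring

theorem exists_common_parameter {E : Type*} [TopologicalSpace E] {K : Set E} (hK : IsCompact K)
    {C₀ C₁ : Set (ℝ × E)} (hC₀ : IsClosed C₀) (hC₁ : IsClosed C₁)
    (hcover : ∀ t ∈ Set.Icc (0 : ℝ) 1, ∃ x ∈ K, (t, x) ∈ C₀ ∪ C₁)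
    (h₀ : ∃ x ∈ K, (0, x) ∈ C₀) (h₁ : ∃ x ∈ K, (1, x) ∈ C₁) :
    ∃ t ∈ Set.Icc (0 : ℝ) 1, (∃ x ∈ K, (t, x) ∈ C₀) ∧ ∃ x ∈ K, (t, x) ∈ C₁ := by
  have hclosed {C : Set (ℝ × E)} (hC : IsClosed C) :
      IsClosed {t | t ∈ Set.Icc (0 : ℝ) 1 ∧ ∃ x ∈ K, (t, x) ∈ C} := by
    convert (((isCompact_Icc (a := (0 : ℝ)) (b := 1)).prod hK).inter_right hC).image
      continuous_fst |>.isClosed using 1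
    ext t
    simp [and_assoc]
  obtain ⟨t, ht, ⟨-, hx⟩, -, hy⟩ :=
    isPreconnected_closed_iff.1 isPreconnected_Icc _ _ (hclosed hC₀) (hclosed hC₁)
      (fun t ht => by
        obtain ⟨x, hx, hC | hC⟩ := hcover t ht
        exacts [Or.inl ⟨ht, x, hx, hC⟩, Or.inr ⟨ht, x, hx, hC⟩])
      ⟨0, by simp, by simp, h₀⟩ ⟨1, by simp, by simp, h₁⟩
  exact ⟨t, ht, hx, hy⟩

variable {E : Type*} [NormedAddCommGroup E] [NormedSpace ℝ E]

theorem quadraticForm_posDef_of_sphere {Q : QuadraticForm ℝ E}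
    (h : ∀ x ∈ Metric.sphere (0 : E) 1, 0 < Q x) : Q.PosDef := by
  intro x hx
  have hn : 0 < ‖x‖ := norm_pos_iff.2 hx
  have hpos := h (‖x‖⁻¹ • x) (by simp [norm_smul, hn.ne'])
  rw [QuadraticMap.map_smul, smul_eq_mul] at hpos
  exact pos_of_mul_pos_right hpos (mul_self_nonneg _)

variable [FiniteDimensional ℝ E]

theorem continuous_quadraticForm (Q : QuadraticForm ℝ E) : Continuous Q := by
  have h : (Q : E → ℝ) =
      fun x => (LinearMap.toContinuousBilinearMap (QuadraticMap.associated Q)) x x := by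
    funext x
    exact (QuadraticMap.associated_eq_self_apply ℝ Q x).symm
  rw [h]
  fun_prop

theorem eventually_quadraticForm_posDef {X : Type*} [TopologicalSpace X]
    {f : X → QuadraticForm ℝ E} (hf : Continuous fun z : X × E => f z.1 z.2) {x₀ : X}
    (h₀ : (f x₀).PosDef) : ∀ᶠ x in 𝓝 x₀, (f x).PosDef := by
  have hsphere : ∀ᶠ x in 𝓝 x₀, ∀ v ∈ Metric.sphere (0 : E) 1, 0 < f x v :=
    (isCompact_sphere _ _).eventually_forall_of_forall_eventually fun v hv =>
      hf.continuousAt.eventually (lt_mem_nhds (h₀ v (ne_zero_of_mem_unit_sphere ⟨v, hv⟩)))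
  exact hsphere.mono fun _ => quadraticForm_posDef_of_sphere

theorem continuous_convexCombination (Q R : QuadraticForm ℝ E) :
    Continuous fun z : ℝ × E => ((1 - z.1) • Q + z.1 • R) z.2 := by
  have hQ := (continuous_quadraticForm Q).comp (continuous_snd (X := ℝ))
  have hR := (continuous_quadraticForm R).comp (continuous_snd (X := ℝ))
  exact ((continuous_const.sub continuous_fst).mul hQ).add (continuous_fst.mul hR)

theorem exists_ne_zero_nonpos_eq_zero {Q R : QuadraticForm ℝ E} {x y : E} (hx : x ≠ 0)
    (hQx : Q x ≤ 0) (hQy : Q y ≤ 0) (hRx : R x ≤ 0) (hRy : 0 < R y) :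
    ∃ z, z ≠ 0 ∧ Q z ≤ 0 ∧ R z = 0 := by
  wlog hpolar : QuadraticMap.polar Q x y ≤ 0 generalizing y
  · exact this (y := -y) (by simpa) (by simpa) (by
      rw [QuadraticMap.polar_neg_right]
      linarith)
  let γ : ℝ → E := fun s => (1 - s) • x + s • y
  have hcont : ContinuousOn (fun s => R (γ s)) (Set.Icc 0 1) :=
    ((continuous_quadraticForm R).comp (by fun_prop)).continuousOn
  obtain ⟨s, ⟨hs0, hs1⟩, hs⟩ : (0 : ℝ) ∈ (fun s => R (γ s)) '' Set.Icc 0 1 :=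
    intermediate_value_Icc zero_le_one hcont
      ⟨by simpa [γ] using hRx, by simpa [γ] using hRy.le⟩
  refine ⟨γ s, fun hγ => ?_, ?_, hs⟩
  · have hR : (1 - s) * (1 - s) * R x = s * s * R y := by
      have hγ' : (1 - s) • x = -(s • y) := eq_neg_of_add_eq_zero_left hγ
      simpa only [QuadraticMap.map_smul, QuadraticMap.map_neg, smul_eq_mul] using congrArg R hγ'
    rcases eq_or_lt_of_le hs0 with rfl | hs_pos
    · exact hx (by simpa [γ] using hγ)
    · nlinarith [mul_pos (mul_pos hs_pos hs_pos) hRy, mul_self_nonneg (1 - s)]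
  · rw [quadraticForm_map_smul_add_smul]
    have hs1' : 0 ≤ 1 - s := sub_nonneg.2 hs1
    have hx := mul_nonneg (sq_nonneg (1 - s)) (neg_nonneg.2 hQx)
    have hy := mul_nonneg (sq_nonneg s) (neg_nonneg.2 hQy)
    have hxy := mul_nonneg (mul_nonneg hs1' hs0) (neg_nonneg.2 hpolar)
    linarith

theorem exists_posDef_convexCombination {Q R : QuadraticForm ℝ E}
    (h : ∀ x, x ≠ 0 → 0 < Q x ∨ 0 < R x) :
    ∃ t ∈ Set.Icc (0 : ℝ) 1, ((1 - t) • Q + t • R).PosDef := by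
  by_contra! hcon
  have hnonpos (t : ℝ) (ht : t ∈ Set.Icc (0 : ℝ) 1) :
      ∃ x ∈ Metric.sphere (0 : E) 1, ((1 - t) • Q + t • R) x ≤ 0 := by
    by_contra! hpos
    exact hcon t ht (quadraticForm_posDef_of_sphere hpos)
  let bad (F : QuadraticForm ℝ E) : Set (ℝ × E) :=
    {z | ((1 - z.1) • Q + z.1 • R) z.2 ≤ 0 ∧ F z.2 ≤ 0}
  have hclosed (F : QuadraticForm ℝ E) : IsClosed (bad F) :=
    (isClosed_le (continuous_convexCombination Q R) continuous_const).inter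
      (isClosed_le ((continuous_quadraticForm F).comp continuous_snd) continuous_const)
  have hcover (t : ℝ) (ht : t ∈ Set.Icc (0 : ℝ) 1) :
      ∃ x ∈ Metric.sphere (0 : E) 1, (t, x) ∈ bad Q ∪ bad R := by
    obtain ⟨x, hx, hle⟩ := hnonpos t ht
    refine ⟨x, hx, ?_⟩
    by_contra! hmem
    simp only [bad, Set.mem_union, Set.mem_ofPred_eq, hle, true_and, not_or, not_le] at hmem
    exact (convex_Ioi (0 : ℝ) hmem.1 hmem.2 (sub_nonneg.2 ht.2) ht.1
      (sub_add_cancel _ _)).not_ge hle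
  obtain ⟨t, ht, ⟨x, hx, hTx, hQx⟩, y, hy, hTy, hRy⟩ :=
    exists_common_parameter (isCompact_sphere 0 1) (hclosed Q) (hclosed R) hcover
      ((hnonpos 0 (by simp)).imp fun x hx => ⟨hx.1, hx.2, by simpa using hx.2⟩)
      ((hnonpos 1 (by simp)).imp fun x hx => ⟨hx.1, hx.2, by simpa using hx.2⟩)
  have hQy : 0 < Q y := (h y (ne_zero_of_mem_unit_sphere ⟨y, hy⟩)).resolve_right hRy.not_gt
  obtain ⟨z, hz, hTz, hQz⟩ := exists_ne_zero_nonpos_eq_zero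
    (ne_zero_of_mem_unit_sphere ⟨x, hx⟩) hTx hTy hQx hQy
  have hRz : 0 < R z := (h z hz).resolve_left hQz.not_gt
  have ht0 : t = 0 := by
    have hTz' : t * R z ≤ 0 := by simpa [hQz] using hTz
    exact le_antisymm (nonpos_of_mul_nonpos_left hTz' hRz) ht.1
  exact hQy.not_ge (by simpa [ht0] using hTy)

theorem exists_pos_posDef_sub_smul {Q R : QuadraticForm ℝ E}
    (h : ∀ x, x ≠ 0 → 0 ≤ R x → 0 < Q x) : ∃ α : ℝ, 0 < α ∧ (Q - α • R).PosDef := by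
  obtain ⟨t₀, ht₀, hpos⟩ := exists_posDef_convexCombination (Q := Q) (R := -R) fun x hx =>
    (le_or_gt 0 (R x)).imp (h x hx) neg_pos.2
  have hmem : t₀ ∈ closure (Set.Ioo (0 : ℝ) 1) := by rwa [closure_Ioo zero_ne_one]
  obtain ⟨t, ⟨ht0, ht1⟩, hposDef⟩ := ((mem_closure_iff_frequently.1 hmem).and_eventually
    (eventually_quadraticForm_posDef (f := fun t : ℝ => (1 - t) • Q + t • (-R))
      (continuous_convexCombination Q (-R)) hpos)).exists
  have ht1' : 0 < 1 - t := sub_pos.2 ht1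
  have hscale : Q - (t / (1 - t)) • R = (1 - t)⁻¹ • ((1 - t) • Q + t • (-R)) := by
    rw [smul_add, inv_smul_smul₀ ht1'.ne', smul_smul, smul_neg, ← sub_eq_add_neg, inv_mul_eq_div]
  exact ⟨t / (1 - t), div_pos ht0 ht1', hscale ▸ hposDef.smul (inv_pos.2 ht1')⟩

end SLemma

section MatrixForms

variable {R ι κ : Type*} [CommRing R] [Fintype ι] [DecidableEq ι] [Fintype κ] [DecidableEq κ]

theorem toQuadraticForm'_apply (Q : Matrix ι ι R) (x : ι → R) :
    Q.toQuadraticForm' x = x ⬝ᵥ Q *ᵥ x :=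
  toLinearMap₂'_apply' Q x x

theorem toQuadraticForm'_sub (P Q : Matrix ι ι R) :
    (P - Q).toQuadraticForm' = P.toQuadraticForm' - Q.toQuadraticForm' := by
  ext x
  simp [toQuadraticForm'_apply, sub_mulVec]

theorem toQuadraticForm'_smul (c : R) (Q : Matrix ι ι R) :
    (c • Q).toQuadraticForm' = c • Q.toQuadraticForm' := by
  ext x
  simp [toQuadraticForm'_apply, smul_mulVec]

theorem toQuadraticForm'_transpose_mul_mul (Q : Matrix κ κ R) (T : Matrix κ ι R) (x : ι → R) :
    (Tᵀ * Q * T).toQuadraticForm' x = Q.toQuadraticForm' (T *ᵥ x) := by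
  rw [toQuadraticForm'_apply, toQuadraticForm'_apply, ← mulVec_mulVec, ← mulVec_mulVec,
    dotProduct_mulVec, vecMul_transpose]

theorem toQuadraticForm'_mul_mul_transpose (Q : Matrix κ κ R) (T : Matrix ι κ R) (x : ι → R) :
    (T * Q * Tᵀ).toQuadraticForm' x = Q.toQuadraticForm' (Tᵀ *ᵥ x) := by
  simpa only [transpose_transpose] using toQuadraticForm'_transpose_mul_mul Q Tᵀ x

theorem toQuadraticForm'_fromBlocks_diagonal (A : Matrix ι ι R) (D : Matrix κ κ R)
    (a : ι → R) (b : κ → R) :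
    (fromBlocks A 0 0 D).toQuadraticForm' (Sum.elim a b) =
      A.toQuadraticForm' a + D.toQuadraticForm' b := by
  simp [toQuadraticForm'_apply, fromBlocks_mulVec, sumElim_dotProduct_sumElim]

theorem posSemidef_iff_toQuadraticForm'_nonneg {Q : Matrix ι ι ℝ} :
    Q.PosSemidef ↔ Q.IsSymm ∧ ∀ x, 0 ≤ Q.toQuadraticForm' x := by
  simp only [posSemidef_iff_dotProduct_mulVec, IsHermitian, conjTranspose_eq_transpose_of_trivial,
    IsSymm, star_trivial, toQuadraticForm'_apply]

end MatrixForms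

theorem eventually_posDef {ι : Type*} [Finite ι] {Q : Matrix ι ι ℝ} (hQ : Q.PosDef) :
    ∀ᶠ P in nhds Q, P.IsSymm → P.PosDef := by
  classical
  cases nonempty_fintype ι
  have hcont : Continuous fun z : Matrix ι ι ℝ × (ι → ℝ) => z.1.toQuadraticForm' z.2 := by
    simp only [toQuadraticForm'_apply]
    fun_prop
  exact (eventually_quadraticForm_posDef hcont hQ.toQuadraticForm').mono
    fun _ hP hsymm => .of_toQuadraticForm' hsymm hP

theorem posDef_smul_iff {ι : Type*} [Nonempty ι] {Q : Matrix ι ι ℝ} (hQ : Q.PosDef) {c : ℝ} :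
    (c • Q).PosDef ↔ 0 < c := by
  refine ⟨fun h => ?_, hQ.smul⟩
  obtain ⟨i⟩ := ‹Nonempty ι›
  exact pos_of_mul_pos_left (h.diag_pos (i := i)) hQ.diag_pos.le

section SchurComplement

open scoped ComplexOrder

variable {𝕜 ι κ : Type*} [RCLike 𝕜]

theorem posDef_fromBlocks₁₁_iff [Fintype ι] [DecidableEq ι] [Finite κ] {A : Matrix ι ι 𝕜}
    (hA : A.PosDef) (B : Matrix κ ι 𝕜) (D : Matrix κ κ 𝕜) :
    (fromBlocks A Bᴴ B D).PosDef ↔ (D - B * A⁻¹ * Bᴴ).PosDef := by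
  classical
  cases nonempty_fintype κ
  have := hA.isUnit.invertible
  have hsemidef : (fromBlocks A Bᴴ B D).PosSemidef ↔ (D - B * A⁻¹ * Bᴴ).PosSemidef := by
    simpa using hA.fromBlocks₁₁ Bᴴ D
  have hunit : IsUnit (fromBlocks A Bᴴ B D) ↔ IsUnit (D - B * A⁻¹ * Bᴴ) := by
    rw [isUnit_fromBlocks_iff_of_invertible₁₁, invOf_eq_nonsing_inv]
  exact ⟨fun h => (hsemidef.1 h.posSemidef).posDef_iff_isUnit.2 (hunit.1 h.isUnit),
    fun h => (hsemidef.2 h.posSemidef).posDef_iff_isUnit.2 (hunit.2 h.isUnit)⟩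

theorem posDef_fromBlocks₂₂_iff [Finite ι] [Fintype κ] [DecidableEq κ] (A : Matrix ι ι 𝕜)
    (B : Matrix κ ι 𝕜) {D : Matrix κ κ 𝕜} (hD : D.PosDef) :
    (fromBlocks A Bᴴ B D).PosDef ↔ (A - Bᴴ * D⁻¹ * B).PosDef := by
  classical
  cases nonempty_fintype ι
  have := hD.isUnit.invertible
  have hsemidef : (fromBlocks A Bᴴ B D).PosSemidef ↔ (A - Bᴴ * D⁻¹ * B).PosSemidef := by
    simpa using hD.fromBlocks₂₂ A Bᴴ
  have hunit : IsUnit (fromBlocks A Bᴴ B D) ↔ IsUnit (A - Bᴴ * D⁻¹ * B) := by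
    rw [isUnit_fromBlocks_iff_of_invertible₂₂, invOf_eq_nonsing_inv]
  exact ⟨fun h => (hsemidef.1 h.posSemidef).posDef_iff_isUnit.2 (hunit.1 h.isUnit),
    fun h => (hsemidef.2 h.posSemidef).posDef_iff_isUnit.2 (hunit.2 h.isUnit)⟩

theorem posDef_fromBlocks_diagonal [Finite ι] [Finite κ] {A : Matrix ι ι 𝕜} {D : Matrix κ κ 𝕜}
    (hA : A.PosDef) (hD : D.PosDef) : (fromBlocks A 0 0 D).PosDef := by
  classical
  cases nonempty_fintype ι
  simpa using (posDef_fromBlocks₁₁_iff hA 0 D).2 (by simpa using hD)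

theorem inv_fromBlocks_diagonal [Fintype ι] [DecidableEq ι] [Fintype κ] [DecidableEq κ]
    {A : Matrix ι ι 𝕜} {D : Matrix κ κ 𝕜} (hA : IsUnit A) (hD : IsUnit D) :
    (fromBlocks A 0 0 D)⁻¹ = fromBlocks A⁻¹ 0 0 D⁻¹ := by
  simp [inv_fromBlocks_zero₂₁_of_isUnit_iff, hA, hD]

end SchurComplement

section H2Inequalities

variable {s w z : Type*} [Fintype s] [DecidableEq w]

theorem posDef_lyapunov_iff [Finite w] {P : Matrix s s ℝ} (hP : P.PosDef)
    (A : Matrix s s ℝ) (B : Matrix s w ℝ) :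
    (fromBlocks (1 : Matrix w w ℝ) Bᵀ B (P - A * P * Aᵀ)).PosDef ↔
      (fromBlocks (fromBlocks P 0 0 (1 : Matrix w w ℝ)) (fromCols (A * P) B)ᵀ
        (fromCols (A * P) B) P).PosDef := by
  classical
  cases nonempty_fintype w
  have hcancel : A * P * P⁻¹ = A :=
    mul_nonsing_inv_cancel_right P A ((isUnit_iff_isUnit_det P).1 hP.isUnit)
  have hPT : Pᵀ = P := by simpa using hP.isHermitian.eq
  have hschur : P - fromCols (A * P) B * (fromBlocks P 0 0 (1 : Matrix w w ℝ))⁻¹ *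
      (fromCols (A * P) B)ᵀ = P - A * P * Aᵀ - B * (1 : Matrix w w ℝ)⁻¹ * Bᵀ := by
    rw [inv_fromBlocks_diagonal hP.isUnit isUnit_one, fromCols_mul_fromBlocks,
      transpose_fromCols, fromCols_mul_fromRows]
    simp [hcancel, hPT, Matrix.mul_assoc, sub_sub]
  simp only [← conjTranspose_eq_transpose_of_trivial] at hschur ⊢
  rw [posDef_fromBlocks₁₁_iff .one,
    posDef_fromBlocks₁₁_iff (posDef_fromBlocks_diagonal hP .one), hschur]

theorem posDef_output_iff [Fintype w] [Finite z] {P : Matrix s s ℝ} (hP : P.PosDef)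
    (Z : Matrix z z ℝ) (C : Matrix z s ℝ) (D : Matrix z w ℝ) :
    (fromBlocks (Z - D * Dᵀ) (C * P) (P * Cᵀ) P).PosDef ↔
      (fromBlocks (fromBlocks (1 : Matrix w w ℝ) Dᵀ D Z) (fromRows 0 (C * P))
        (fromRows 0 (C * P))ᵀ P).PosDef := by
  classical
  have hPT : Pᵀ = P := by simpa using hP.isHermitian.eq
  have hcancel : P⁻¹ * (P * Cᵀ) = Cᵀ :=
    nonsing_inv_mul_cancel_left P Cᵀ ((isUnit_iff_isUnit_det P).1 hP.isUnit)
  have hleft : (fromBlocks (Z - D * Dᵀ) (C * P) (P * Cᵀ) P).PosDef ↔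
      (Z - D * Dᵀ - C * P * Cᵀ).PosDef := by
    simpa [hPT, hcancel, Matrix.mul_assoc] using
      posDef_fromBlocks₂₂_iff (Z - D * Dᵀ) (P * Cᵀ) hP
  have hschur : fromBlocks 1 Dᵀ D Z - fromRows (0 : Matrix w s ℝ) (C * P) * P⁻¹ *
      (fromRows 0 (C * P))ᵀ = fromBlocks 1 Dᵀ D (Z - C * P * Cᵀ) := by
    rw [transpose_fromRows, fromRows_mul, fromRows_mul_fromCols, sub_eq_add_neg, fromBlocks_neg,
      fromBlocks_add]
    simp [hPT, hcancel, Matrix.mul_assoc, sub_eq_add_neg]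
  have hright : (fromBlocks (fromBlocks (1 : Matrix w w ℝ) Dᵀ D Z) (fromRows 0 (C * P))
      (fromRows 0 (C * P))ᵀ P).PosDef ↔ (fromBlocks (1 : Matrix w w ℝ) Dᵀ D
        (Z - C * P * Cᵀ)).PosDef := by
    rw [← hschur]
    simpa only [conjTranspose_eq_transpose_of_trivial, transpose_transpose] using
      posDef_fromBlocks₂₂_iff (fromBlocks (1 : Matrix w w ℝ) Dᵀ D Z) (fromRows 0 (C * P))ᵀ hP
  rw [hleft, hright, sub_right_comm]
  simpa using (posDef_fromBlocks₁₁_iff (.one (n := w) (R := ℝ)) D (Z - C * P * Cᵀ)).symm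

end H2Inequalities

section RankOneUncertainty

variable {p q r : Type*} [Fintype q] [DecidableEq q] [Fintype r] [DecidableEq r]

theorem sq_dotProduct_mulVec_le {Q : Matrix q q ℝ} (hQ : Q.PosSemidef) (x y : q → ℝ) :
    (x ⬝ᵥ Q *ᵥ y) ^ 2 ≤ Q.toQuadraticForm' x * Q.toQuadraticForm' y := by
  obtain ⟨hsymm, hnonneg⟩ := posSemidef_iff_toQuadraticForm'_nonneg.1 hQ
  simpa [toLinearMap₂'_apply', toQuadraticForm'_apply] using
    LinearMap.BilinForm.apply_sq_le_of_symm (toLinearMap₂' ℝ Q) hnonneg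
      ⟨fun x y => by
        simpa [toLinearMap₂'_apply', hsymm.eq] using dotProduct_transpose_mulVec Q x y⟩ x y

theorem exists_posSemidef_sub_mulVec_eq {Γ : Matrix r r ℝ} {Λ : Matrix q q ℝ} (hΓ : Γ.PosDef)
    (hΛ : Λ.PosDef) {g : q → ℝ} {ξ : r → ℝ}
    (h : Γ.toQuadraticForm' ξ ≤ Λ.toQuadraticForm' g) :
    ∃ D : Matrix q r ℝ, (Λ - D * Γ * Dᵀ).PosSemidef ∧ Dᵀ *ᵥ g = ξ := by
  set D := (Λ.toQuadraticForm' g)⁻¹ • vecMulVec (Λ *ᵥ g) ξ with hDdef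
  have hD (z : q → ℝ) : Dᵀ *ᵥ z = ((Λ.toQuadraticForm' g)⁻¹ * (z ⬝ᵥ Λ *ᵥ g)) • ξ := by
    rw [hDdef, transpose_smul, transpose_vecMulVec, smul_mulVec, vecMulVec_mulVec, ← smul_smul,
      dotProduct_comm]
    simp
  have hsymm : (Λ - D * Γ * Dᵀ).IsSymm := by
    simpa [IsHermitian, IsSymm] using
      hΛ.isHermitian.sub (isHermitian_mul_mul_conjTranspose D hΓ.isHermitian)
  have hcs (z : q → ℝ) := sq_dotProduct_mulVec_le hΛ.posSemidef z g
  have hnonneg := (posSemidef_iff_toQuadraticForm'_nonneg.1 hΛ.posSemidef).2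
  refine ⟨D, posSemidef_iff_toQuadraticForm'_nonneg.2 ⟨hsymm, fun z => ?_⟩, ?_⟩
  · rw [toQuadraticForm'_sub, _root_.sub_apply, toQuadraticForm'_mul_mul_transpose, hD,
      QuadraticMap.map_smul, sub_nonneg, smul_eq_mul]
    set k := Λ.toQuadraticForm' g
    calc k⁻¹ * (z ⬝ᵥ Λ *ᵥ g) * (k⁻¹ * (z ⬝ᵥ Λ *ᵥ g)) * Γ.toQuadraticForm' ξ
        ≤ k⁻¹ * (z ⬝ᵥ Λ *ᵥ g) * (k⁻¹ * (z ⬝ᵥ Λ *ᵥ g)) * k :=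
          mul_le_mul_of_nonneg_left h (mul_self_nonneg _)
      _ = (z ⬝ᵥ Λ *ᵥ g) ^ 2 / k := by
          by_cases hk : k = 0
          · simp [hk]
          · field_simp
      _ ≤ Λ.toQuadraticForm' z := div_le_of_le_mul₀ (hnonneg g) (hnonneg z) (hcs z)
  · rw [hD, ← toQuadraticForm'_apply]
    by_cases hg : g = 0
    · have hξ : ξ = 0 := by
        by_contra hξ
        have := hΓ.toQuadraticForm' ξ hξ
        rw [hg, map_zero] at h
        exact this.not_ge h
      simp [hξ]
    · rw [inv_mul_cancel₀ (hΛ.toQuadraticForm' g hg).ne', one_smul]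

theorem exists_conj_posSemidef_sub_mulVec_eq [Fintype p] {Γ : Matrix r r ℝ} {Λ : Matrix q q ℝ}
    (hΓ : Γ.PosDef) (hΛ : Λ.PosDef) (Ξ : Matrix p q ℝ) {x : p → ℝ} {ξ : r → ℝ}
    (h : Γ.toQuadraticForm' ξ ≤ Λ.toQuadraticForm' (Ξᵀ *ᵥ x)) :
    ∃ D : Matrix p r ℝ, (Ξ * Λ * Ξᵀ - D * Γ * Dᵀ).PosSemidef ∧ Dᵀ *ᵥ x = ξ := by
  obtain ⟨D, hD, hξ⟩ := exists_posSemidef_sub_mulVec_eq hΓ hΛ h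
  refine ⟨Ξ * D, ?_, by rw [transpose_mul, ← mulVec_mulVec, hξ]⟩
  simpa [Matrix.mul_sub, Matrix.sub_mul, Matrix.mul_assoc] using hD.mul_mul_conjTranspose_same Ξ

end RankOneUncertainty

section Petersen

variable {a b p q r : Type*}

theorem posDef_submatrix_equiv_iff {ι κ : Type*} (e : κ ≃ ι) {Q : Matrix ι ι ℝ} :
    (Q.submatrix e e).PosDef ↔ Q.PosDef :=
  ⟨fun h => by simpa using h.submatrix e.symm.injective, fun h => h.submatrix e.injective⟩

/-- The matrix of the quadratic form `(x, y, ξ) ↦ xᵀSx + 2yᵀGx + 2ξᵀMx + yᵀPy`, in which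
`ξ = DᵀEᵀy` is the signal that enters through an uncertainty `G + EDM`. -/
def uncertainMat (S : Matrix a a ℝ) (G : Matrix b a ℝ) (M : Matrix r a ℝ) (P : Matrix b b ℝ) :
    Matrix (a ⊕ (b ⊕ r)) (a ⊕ (b ⊕ r)) ℝ :=
  fromBlocks S (fromRows G M)ᵀ (fromRows G M) (fromBlocks P 0 0 0)

/-- The matrix of the quadratic form `(x, y, ξ) ↦ yᵀFΛFᵀy - ξᵀΓξ`, which is nonnegative where `ξ`
is the response to `y` of an admissible uncertainty. -/
def ellipsoidMat (a : Type*) [Fintype q] (F : Matrix b q ℝ) (Γ : Matrix r r ℝ) (Λ : Matrix q q ℝ) :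
    Matrix (a ⊕ (b ⊕ r)) (a ⊕ (b ⊕ r)) ℝ :=
  fromBlocks 0 0 0 (fromBlocks (F * Λ * Fᵀ) 0 0 (-Γ))

/-- The block matrix, affine in the multiplier `α`, that certifies robust definiteness of
`fromBlocks S (G + E * D * M)ᵀ (G + E * D * M) P` with `F = E * Ξ` over the ellipsoid
`D * Γ * Dᵀ ⪯ Ξ * Λ * Ξᵀ`. -/
noncomputable def multiplierMat [Fintype q] [DecidableEq q] (S : Matrix a a ℝ) (G : Matrix b a ℝ)
    (M : Matrix r a ℝ) (P : Matrix b b ℝ) (F : Matrix b q ℝ) (Γ : Matrix r r ℝ) (Λ : Matrix q q ℝ)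
    (α : ℝ) : Matrix (a ⊕ (b ⊕ (r ⊕ q))) (a ⊕ (b ⊕ (r ⊕ q))) ℝ :=
  fromBlocks S (fromRows G (fromRows M 0))ᵀ (fromRows G (fromRows M 0))
    (fromBlocks P (fromRows 0 (α • Fᵀ))ᵀ (fromRows 0 (α • Fᵀ))
      (fromBlocks (α • Γ) 0 0 (α • Λ⁻¹)))

/-- The map `(x, y) ↦ (x, y, Kᵀy)` that appends to `(x, y)` the response of the uncertainty `K`. -/
def responseMat (a : Type*) [DecidableEq a] [DecidableEq b] (K : Matrix b r ℝ) :
    Matrix (a ⊕ (b ⊕ r)) (a ⊕ b) ℝ :=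
  fromBlocks 1 0 0 (fromRows 1 Kᵀ)

theorem posSemidef_fromBlocks_zero₂₂ {ι κ : Type*} [Finite ι] [Finite κ]
    {A : Matrix κ κ ℝ} (hA : A.PosSemidef) :
    (fromBlocks (0 : Matrix ι ι ℝ) 0 0 A).PosSemidef := by
  classical
  cases nonempty_fintype ι
  cases nonempty_fintype κ
  refine posSemidef_iff_toQuadraticForm'_nonneg.2 ⟨?_, fun x => ?_⟩
  · exact isSymm_zero.fromBlocks rfl (by simpa using hA.isHermitian)
  · rw [← Sum.elim_comp_inl_inr x, toQuadraticForm'_fromBlocks_diagonal]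
    simpa [toQuadraticForm'_apply] using
      (posSemidef_iff_toQuadraticForm'_nonneg.1 hA).2 (x ∘ Sum.inr)

section ResponseMat

variable [Fintype a] [DecidableEq a] [Fintype b] [DecidableEq b] (K : Matrix b r ℝ)

theorem responseMat_transpose_mul_uncertainMat_mul [Fintype r] (S : Matrix a a ℝ)
    (G : Matrix b a ℝ) (M : Matrix r a ℝ) (P : Matrix b b ℝ) :
    (responseMat a K)ᵀ * uncertainMat S G M P * responseMat a K =
      fromBlocks S (G + K * M)ᵀ (G + K * M) P := by
  simp only [responseMat, uncertainMat, fromBlocks_transpose, transpose_fromRows,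
    fromBlocks_multiply, fromCols_mul_fromRows, fromCols_mul_fromBlocks]
  simp [fromCols_mul_fromRows]

theorem responseMat_transpose_mul_ellipsoidMat_mul [Fintype r] [Fintype q] (F : Matrix b q ℝ)
    (Γ : Matrix r r ℝ) (Λ : Matrix q q ℝ) :
    (responseMat a K)ᵀ * ellipsoidMat a F Γ Λ * responseMat a K =
      fromBlocks 0 0 0 (F * Λ * Fᵀ - K * Γ * Kᵀ) := by
  simp only [responseMat, ellipsoidMat, fromBlocks_transpose, transpose_fromRows,
    fromBlocks_multiply, fromCols_mul_fromBlocks]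
  simp [fromCols_mul_fromRows, sub_eq_add_neg]

theorem injective_responseMat_mulVec [Finite r] :
    Function.Injective (responseMat a K).mulVec := by
  cases nonempty_fintype r
  refine Function.LeftInverse.injective
    (g := (fromBlocks 1 0 0 (fromCols 1 0) : Matrix (a ⊕ b) (a ⊕ (b ⊕ r)) ℝ).mulVec) fun z => ?_
  simp [responseMat, fromBlocks_multiply, fromCols_mul_fromRows]

end ResponseMat

theorem exists_eq_responseMat_mulVec [Fintype a] [DecidableEq a] [Fintype b] [DecidableEq b]
    [Fintype p] [Fintype q] [Fintype r] [DecidableEq r] {Γ : Matrix r r ℝ} {Λ : Matrix q q ℝ}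
    (hΓ : Γ.PosDef) (hΛ : Λ.PosDef) (Ξ : Matrix p q ℝ) (E : Matrix b p ℝ) {z : a ⊕ (b ⊕ r) → ℝ}
    (hz : 0 ≤ (ellipsoidMat a (E * Ξ) Γ Λ).toQuadraticForm' z) :
    ∃ D : Matrix p r ℝ, (Ξ * Λ * Ξᵀ - D * Γ * Dᵀ).PosSemidef ∧
      ∃ c, z = responseMat a (E * D) *ᵥ c := by
  classical
  obtain ⟨x, v, rfl⟩ : ∃ x v, z = Sum.elim x v := ⟨_, _, (Sum.elim_comp_inl_inr z).symm⟩
  obtain ⟨y, ξ, rfl⟩ : ∃ y ξ, v = Sum.elim y ξ := ⟨_, _, (Sum.elim_comp_inl_inr v).symm⟩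
  rw [ellipsoidMat, toQuadraticForm'_fromBlocks_diagonal, toQuadraticForm'_fromBlocks_diagonal,
    toQuadraticForm'_mul_mul_transpose, transpose_mul, ← mulVec_mulVec] at hz
  obtain ⟨D, hD, hξ⟩ := exists_conj_posSemidef_sub_mulVec_eq hΓ hΛ Ξ (x := Eᵀ *ᵥ y) (ξ := ξ) (by
    simpa [toQuadraticForm'_apply, neg_mulVec] using hz)
  refine ⟨D, hD, Sum.elim x y, ?_⟩
  simp [responseMat, fromBlocks_mulVec, fromRows_mulVec, ← hξ, transpose_mul]

variable [Fintype q] [DecidableEq q] {S : Matrix a a ℝ} {G : Matrix b a ℝ} {M : Matrix r a ℝ}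
  {P : Matrix b b ℝ} {F : Matrix b q ℝ} {Γ : Matrix r r ℝ} {Λ : Matrix q q ℝ} {α : ℝ}

theorem multiplierMat_submatrix :
    (multiplierMat S G M P F Γ Λ α).submatrix
        ((Equiv.sumAssoc a (b ⊕ r) q).trans ((Equiv.refl a).sumCongr (Equiv.sumAssoc b r q)))
        ((Equiv.sumAssoc a (b ⊕ r) q).trans ((Equiv.refl a).sumCongr (Equiv.sumAssoc b r q))) =
      fromBlocks
        (fromBlocks S (fromRows G M)ᵀ (fromRows G M) (fromBlocks P 0 0 (α • Γ)))
        (α • fromCols 0 (fromCols Fᵀ 0))ᵀ (α • fromCols 0 (fromCols Fᵀ 0)) (α • Λ⁻¹) := by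
  ext ((i | i | i) | i) ((j | j | j) | j) <;> simp [multiplierMat]

theorem exists_pos_posDef_multiplierMat [Finite r] (hΓ : Γ.PosDef) (hΛ : Λ.PosDef)
    (h : (multiplierMat S G M P F Γ Λ α).PosDef) :
    ∃ β > 0, (multiplierMat S G M P F Γ Λ β).PosDef := by
  have hcorner : (α • fromBlocks Γ 0 0 Λ⁻¹).PosDef := by
    convert h.submatrix (e := Sum.inr ∘ Sum.inr) (Sum.inr_injective.comp Sum.inr_injective)
    rw [fromBlocks_smul, smul_zero, smul_zero]
    rfl
  rcases isEmpty_or_nonempty (r ⊕ q) with hrq | hrq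
  · refine ⟨1, one_pos, ?_⟩
    convert h using 1
    ext (i | i | i) (j | j | j) <;> first | rfl | exact isEmptyElim i | exact isEmptyElim j
  · exact ⟨α, (posDef_smul_iff (posDef_fromBlocks_diagonal hΓ hΛ.inv)).1 hcorner, h⟩

theorem posDef_multiplierMat_iff [Finite a] [Finite b] [Finite r] (hα : 0 < α) (hΛ : Λ.PosDef) :
    (multiplierMat S G M P F Γ Λ α).PosDef ↔
      (uncertainMat S G M P - α • ellipsoidMat a F Γ Λ).PosDef := by
  have hinv : (α • Λ⁻¹)⁻¹ = α⁻¹ • Λ := by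
    refine inv_eq_right_inv ?_
    rw [smul_mul_smul_comm, mul_inv_cancel₀ hα.ne', one_smul,
      nonsing_inv_mul _ ((isUnit_iff_isUnit_det Λ).1 hΛ.isUnit)]
  have hschur : fromBlocks S (fromRows G M)ᵀ (fromRows G M) (fromBlocks P 0 0 (α • Γ)) -
      (α • (fromCols 0 (fromCols Fᵀ 0) : Matrix q (a ⊕ (b ⊕ r)) ℝ))ᵀ * (α • Λ⁻¹)⁻¹ *
        (α • fromCols 0 (fromCols Fᵀ 0)) =
      uncertainMat S G M P - α • ellipsoidMat a F Γ Λ := by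
    rw [hinv, transpose_smul]
    simp only [Matrix.smul_mul, Matrix.mul_smul, smul_smul, transpose_fromCols,
      fromRows_mul, uncertainMat, ellipsoidMat, fromBlocks_smul, sub_eq_add_neg,
      fromBlocks_neg, fromBlocks_add]
    ext (i | i | i) (j | j | j) <;> simp [inv_mul_cancel₀ hα.ne']
  rw [← posDef_submatrix_equiv_iff, multiplierMat_submatrix, ← hschur]
  simpa only [conjTranspose_eq_transpose_of_trivial] using posDef_fromBlocks₂₂_iff
    (fromBlocks S (fromRows G M)ᵀ (fromRows G M) (fromBlocks P 0 0 (α • Γ)))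
    (α • (fromCols 0 (fromCols Fᵀ 0) : Matrix q (a ⊕ (b ⊕ r)) ℝ)) (hΛ.inv.smul hα)

variable [Fintype p]

theorem posDef_of_posDef_multiplierMat [Finite a] [Finite b] [Fintype r] (hα : 0 < α)
    (hΛ : Λ.PosDef) {Ξ : Matrix p q ℝ} {E : Matrix b p ℝ}
    (h : (multiplierMat S G M P (E * Ξ) Γ Λ α).PosDef) {D : Matrix p r ℝ}
    (hD : (Ξ * Λ * Ξᵀ - D * Γ * Dᵀ).PosSemidef) :
    (fromBlocks S (G + E * D * M)ᵀ (G + E * D * M) P).PosDef := by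
  classical
  cases nonempty_fintype a
  cases nonempty_fintype b
  have hell : ((responseMat a (E * D))ᵀ * ellipsoidMat a (E * Ξ) Γ Λ *
      responseMat a (E * D)).PosSemidef := by
    rw [responseMat_transpose_mul_ellipsoidMat_mul]
    refine posSemidef_fromBlocks_zero₂₂ ?_
    simpa [Matrix.mul_sub, Matrix.sub_mul, Matrix.mul_assoc] using hD.mul_mul_conjTranspose_same E
  have hdiff := ((posDef_multiplierMat_iff hα hΛ).1 h).conjTranspose_mul_mul_same
    (injective_responseMat_mulVec (E * D))
  have hsum := hdiff.add_posSemidef (hell.smul hα.le)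
  rwa [conjTranspose_eq_transpose_of_trivial, Matrix.mul_sub, Matrix.sub_mul, Matrix.mul_smul,
    Matrix.smul_mul, sub_add_cancel, responseMat_transpose_mul_uncertainMat_mul] at hsum

theorem exists_posDef_multiplierMat [Finite a] [Finite b] [Fintype r] (hΓ : Γ.PosDef)
    (hΛ : Λ.PosDef) {Ξ : Matrix p q ℝ} {E : Matrix b p ℝ}
    (h : ∀ D : Matrix p r ℝ, (Ξ * Λ * Ξᵀ - D * Γ * Dᵀ).PosSemidef →
      (fromBlocks S (G + E * D * M)ᵀ (G + E * D * M) P).PosDef) :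
    ∃ α, (multiplierMat S G M P (E * Ξ) Γ Λ α).PosDef := by
  classical
  cases nonempty_fintype a
  cases nonempty_fintype b
  obtain ⟨α, hα, hpos⟩ := exists_pos_posDef_sub_smul
    (Q := (uncertainMat S G M P).toQuadraticForm')
    (R := (ellipsoidMat a (E * Ξ) Γ Λ).toQuadraticForm') (by
      intro z hz hz0
      obtain ⟨D, hD, c, rfl⟩ := exists_eq_responseMat_mulVec hΓ hΛ Ξ E hz0
      rw [← toQuadraticForm'_transpose_mul_mul, responseMat_transpose_mul_uncertainMat_mul]
      refine (h D hD).toQuadraticForm' c ?_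
      rintro rfl
      exact hz (mulVec_zero _))
  have hΓs : Γ.IsSymm := by simpa using hΓ.isHermitian
  have hΛs : (Ξ * Λ * Ξᵀ).PosSemidef := by
    simpa using hΛ.posSemidef.mul_mul_conjTranspose_same Ξ
  have hsymm : (fromBlocks S Gᵀ G P).IsSymm := by
    simpa using (h 0 (by simpa using hΛs)).isHermitian
  refine ⟨α, (posDef_multiplierMat_iff hα hΛ).2 (.of_toQuadraticForm' ?_ ?_)⟩
  · obtain ⟨hS, -, -, hP⟩ := isSymm_fromBlocks_iff.1 hsymm
    refine .sub (hS.fromBlocks (transpose_transpose _) (hP.fromBlocks (by simp) isSymm_zero)) ?_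
    refine .smul (isSymm_zero.fromBlocks (by simp) (.fromBlocks ?_ (by simp) hΓs.neg)) α
    simpa [IsSymm, IsHermitian] using isHermitian_mul_mul_conjTranspose (E * Ξ) hΛ.isHermitian
  · rwa [toQuadraticForm'_sub, toQuadraticForm'_smul]

theorem exists_posDef_multiplierMat_iff [Finite a] [Finite b] [Fintype r] (hΓ : Γ.PosDef)
    (hΛ : Λ.PosDef) (Ξ : Matrix p q ℝ) (E : Matrix b p ℝ) :
    (∃ α, (multiplierMat S G M P (E * Ξ) Γ Λ α).PosDef) ↔
      ∀ D : Matrix p r ℝ, (Ξ * Λ * Ξᵀ - D * Γ * Dᵀ).PosSemidef →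
        (fromBlocks S (G + E * D * M)ᵀ (G + E * D * M) P).PosDef := by
  refine ⟨fun ⟨α, h⟩ D hD => ?_, exists_posDef_multiplierMat hΓ hΛ⟩
  obtain ⟨β, hβ, h⟩ := exists_pos_posDef_multiplierMat hΓ hΛ h
  exact posDef_of_posDef_multiplierMat hβ hΛ h hD

end Petersen

section FullRank

variable {ι κ ν : Type*} [Fintype κ]

theorem linearIndependent_row_of_rank_eq {K : Type*} [Field K] [Fintype ι] {M : Matrix ι κ K}
    (h : M.rank = Fintype.card ι) : LinearIndependent K M.row := by
  rw [linearIndependent_iff_card_eq_finrank_span, ← h, rank_eq_finrank_span_row, Set.finrank]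

theorem linearIndependent_col_of_rank_eq {K : Type*} [Field K] [Finite ι] {M : Matrix ι κ K}
    (h : M.rank = Fintype.card κ) : LinearIndependent K M.col := by
  cases nonempty_fintype ι
  rw [← row_transpose]
  exact linearIndependent_row_of_rank_eq (by rw [rank_transpose, h])

theorem isUnit_of_rank_eq {K : Type*} [Field K] [DecidableEq κ] {M : Matrix κ κ K}
    (h : M.rank = Fintype.card κ) : IsUnit M :=
  linearIndependent_rows_iff_isUnit.1 (linearIndependent_row_of_rank_eq h)

theorem isUnit_mul_transpose_self [Fintype ι] [DecidableEq ι] {M : Matrix ι κ ℝ}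
    (hM : LinearIndependent ℝ M.row) : IsUnit (M * Mᵀ) :=
  (PosDef.mul_conjTranspose_self M (vecMul_injective_iff.2 hM)).isUnit

theorem rectInv_mul_self [Fintype ι] [DecidableEq κ] {M : Matrix ι κ ℝ}
    (hM : LinearIndependent ℝ M.col) : rectInv M * M = 1 := by
  have hunit : IsUnit (Mᵀ * M) := isUnit_mul_transpose_self (M := Mᵀ) hM
  rw [rectInv, Matrix.mul_assoc, nonsing_inv_mul _ ((isUnit_iff_isUnit_det _).1 hunit)]

theorem mul_rectInv_mul_of_transpose_mulVec_eq_zero [Fintype ι] [DecidableEq κ]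
    {M : Matrix ι κ ℝ} (hM : LinearIndependent ℝ M.col) {E : Matrix ι ν ℝ}
    (h : ∀ x, Mᵀ *ᵥ x = 0 → Eᵀ *ᵥ x = 0) : M * (rectInv M * E) = E := by
  classical
  have hM0 : Mᵀ * (1 - M * rectInv M)ᵀ = 0 := by
    rw [← transpose_mul, Matrix.sub_mul, Matrix.mul_assoc, rectInv_mul_self hM]
    simp
  have hE0 : Eᵀ * (1 - M * rectInv M)ᵀ = 0 := by
    refine ext_of_mulVec_single fun i => ?_
    rw [← mulVec_mulVec, zero_mulVec]
    exact h _ (by rw [mulVec_mulVec, hM0, zero_mulVec])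
  rw [← transpose_mul, transpose_eq_zero, Matrix.sub_mul, Matrix.one_mul, sub_eq_zero] at hE0
  rw [← Matrix.mul_assoc, ← hE0]

end FullRank

section KernelBasis

variable {ι κ ν : Type*} [Fintype κ]

theorem mul_transpose_eq_zero_of_span_row_eq_ker {R : Type*} [CommRing R] {N : Matrix ν κ R}
    {M : Matrix ι κ R} (hN : Submodule.span R (Set.range N.row) = LinearMap.ker M.mulVecLin) :
    N * Mᵀ = 0 := by
  ext i j
  have hmem : N.row i ∈ LinearMap.ker M.mulVecLin := hN ▸ Submodule.subset_span ⟨i, rfl⟩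
  exact (dotProduct_comm _ _).trans (congrFun (LinearMap.mem_ker.1 hmem) j)

variable [Fintype ι] [DecidableEq ι]

theorem linearIndependent_col_fromRows [Finite ν] {N : Matrix ν κ ℝ} {M : Matrix ι κ ℝ}
    (hN : Submodule.span ℝ (Set.range N.row) = LinearMap.ker M.mulVecLin)
    {G : Matrix ι ι ℝ} (hG : IsUnit G) : LinearIndependent ℝ (fromRows N (G * M)).col := by
  cases nonempty_fintype ν
  rw [← mulVec_injective_iff]
  refine (injective_iff_map_eq_zero (fromRows N (G * M)).mulVecLin).2 fun x hx => ?_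
  rw [mulVecLin_apply, fromRows_mulVec, ← Sum.elim_zero_zero, Sum.elim_eq_iff,
    ← mulVec_mulVec] at hx
  have hMx : M *ᵥ x = 0 := mulVec_injective_of_isUnit hG (by rw [hx.2, mulVec_zero])
  have hspan : x ∈ Submodule.span ℝ (Set.range N.row) := hN ▸ hMx
  rw [← range_vecMulLinear] at hspan
  obtain ⟨c, hc⟩ := hspan
  rw [← dotProduct_self_eq_zero]
  nth_rw 1 [← hc]
  rw [vecMulLinear_apply, ← dotProduct_mulVec, hx.1, dotProduct_zero]

theorem rectInv_fromRows_mul_fromRows_zero_one [Fintype ν] [DecidableEq κ]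
    {N : Matrix ν κ ℝ} {M : Matrix ι κ ℝ} (hM : LinearIndependent ℝ M.row)
    (hN : Submodule.span ℝ (Set.range N.row) = LinearMap.ker M.mulVecLin) :
    rectInv (fromRows N ((M * Mᵀ)⁻¹ * M)) * (fromRows 0 1 : Matrix (ν ⊕ ι) ι ℝ) = Mᵀ := by
  have hunit := isUnit_mul_transpose_self hM
  have hprod : fromRows N ((M * Mᵀ)⁻¹ * M) * Mᵀ = (fromRows 0 1 : Matrix (ν ⊕ ι) ι ℝ) := by
    rw [fromRows_mul, mul_transpose_eq_zero_of_span_row_eq_ker hN, Matrix.mul_assoc,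
      nonsing_inv_mul _ ((isUnit_iff_isUnit_det _).1 hunit)]
  rw [← hprod, ← Matrix.mul_assoc,
    rectInv_mul_self (linearIndependent_col_fromRows hN (isUnit_nonsing_inv_iff.2 hunit)),
    Matrix.one_mul]

end KernelBasis

section QuadraticMatrixInequality

variable {R ι κ ν : Type*} [CommRing R]

/-- The block row `(I T)`: the quadratic matrix inequalities that bound the noise and the parameters
read `(I T) Φ (I T)ᵀ ⪰ 0`. -/
def paramRow [DecidableEq ι] (T : Matrix ι κ R) : Matrix ι (ι ⊕ κ) R :=
  fromCols 1 T

theorem eq_fromBlocks_of_isSymm {R : Type*} {M : Matrix (ι ⊕ κ) (ι ⊕ κ) R} (hM : M.IsSymm) :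
    M = fromBlocks M.toBlocks₁₁ M.toBlocks₁₂ M.toBlocks₁₂ᵀ M.toBlocks₂₂ := by
  have h₂₁ : M.toBlocks₂₁ = M.toBlocks₁₂ᵀ := ext fun i j => hM.apply (Sum.inl j) (Sum.inr i)
  rw [← h₂₁, fromBlocks_toBlocks]

variable [Fintype κ]

theorem mul_paramRow [DecidableEq κ] (M : Matrix ι κ R) (W : Matrix κ ν R) :
    M * paramRow W = fromCols M (M * W) := by
  rw [paramRow, mul_fromCols, Matrix.mul_one]

theorem paramRow_mul_fromBlocks_mul_transpose [Fintype ι] [DecidableEq ι]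
    {A : Matrix ι ι R} {D : Matrix κ κ R} (hD : D.IsSymm) (T T₀ : Matrix ι κ R) :
    paramRow T * fromBlocks A (-(T₀ * D)) (-(T₀ * D))ᵀ D * (paramRow T)ᵀ =
      paramRow T₀ * fromBlocks A (-(T₀ * D)) (-(T₀ * D))ᵀ D * (paramRow T₀)ᵀ +
        (T - T₀) * D * (T - T₀)ᵀ := by
  simp only [paramRow, transpose_fromCols, fromCols_mul_fromBlocks, fromCols_mul_fromRows,
    transpose_one, Matrix.mul_one, Matrix.one_mul, transpose_sub, transpose_neg, transpose_mul,
    hD.eq, Matrix.mul_neg, Matrix.neg_mul, Matrix.mul_sub, Matrix.sub_mul, Matrix.add_mul,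
    Matrix.mul_assoc]
  abel

theorem transpose_mulVec_eq_zero_of_posSemidef [Fintype ι] [Fintype ν]
    {Φ : Matrix (κ ⊕ ν) (κ ⊕ ν) ℝ} (hΦ : (-Φ.toBlocks₂₂).PosDef) {M : Matrix ι κ ℝ}
    {E : Matrix ι ν ℝ} (h : (fromCols M E * Φ * (fromCols M E)ᵀ).PosSemidef) {x : ι → ℝ}
    (hx : Mᵀ *ᵥ x = 0) : Eᵀ *ᵥ x = 0 := by
  classical
  by_contra hne
  have hneg := hΦ.toQuadraticForm' _ hne
  have hnonneg := (posSemidef_iff_toQuadraticForm'_nonneg.1 h).2 x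
  rw [toQuadraticForm'_mul_mul_transpose, transpose_fromCols, fromRows_mulVec, hx,
    ← fromBlocks_toBlocks Φ] at hnonneg
  simp only [toQuadraticForm'_apply, fromBlocks_mulVec, sumElim_dotProduct_sumElim, mulVec_zero,
    zero_dotProduct, zero_add, Sum.elim_comp_inl, Sum.elim_comp_inr] at hnonneg
  simp only [toQuadraticForm'_apply, neg_mulVec, dotProduct_neg] at hneg
  linarith

theorem exists_mul_eq_posSemidef_iff [Finite ι] [DecidableEq κ] [Fintype ν]
    {Φ : Matrix (κ ⊕ ν) (κ ⊕ ν) ℝ} (hΦ : (-Φ.toBlocks₂₂).PosDef) {M : Matrix ι κ ℝ}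
    (hM : LinearIndependent ℝ M.col) {E : Matrix ι ν ℝ} :
    (∃ W : Matrix κ ν ℝ, (paramRow W * Φ * (paramRow W)ᵀ).PosSemidef ∧ M * W = E) ↔
      (fromCols M E * Φ * (fromCols M E)ᵀ).PosSemidef := by
  classical
  cases nonempty_fintype ι
  have hfactor (W : Matrix κ ν ℝ) : fromCols M (M * W) * Φ * (fromCols M (M * W))ᵀ =
      M * (paramRow W * Φ * (paramRow W)ᵀ) * Mᵀ := by
    simp only [← mul_paramRow, transpose_mul, Matrix.mul_assoc]
  constructor
  · rintro ⟨W, hW, rfl⟩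
    rw [hfactor]
    exact hW.mul_mul_conjTranspose_same M
  · intro h
    have hE := mul_rectInv_mul_of_transpose_mulVec_eq_zero hM fun x =>
      transpose_mulVec_eq_zero_of_posSemidef hΦ h
    refine ⟨rectInv M * E, ?_, hE⟩
    rw [← hE, hfactor] at h
    have hinv : Mᵀ * (rectInv M)ᵀ = 1 := by
      rw [← transpose_mul, rectInv_mul_self hM, transpose_one]
    have hconj := h.mul_mul_conjTranspose_same (rectInv M)
    rwa [conjTranspose_eq_transpose_of_trivial, Matrix.mul_assoc M, ← Matrix.mul_assoc,
      rectInv_mul_self hM, Matrix.one_mul, Matrix.mul_assoc, hinv, Matrix.mul_one] at hconj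

end QuadraticMatrixInequality

namespace Setup

section Data

variable {k p m mw md N pz pc n q : ℕ} {S : Setup k p m mw md N pz pc n q}

theorem isSymm_H (hΦ : S.Φ.IsSymm) : S.H.IsSymm := by
  simp only [IsSymm, H, transpose_mul, transpose_transpose, hΦ.eq, Matrix.mul_assoc]

theorem isSymm_Hlow (hΦ : S.Φ.IsSymm) : S.Hlow.IsSymm :=
  (isSymm_H hΦ).submatrix Sum.inr

theorem Hlow_eq : S.Hlow = S.regressor * S.Φ.toBlocks₂₂ * S.regressorᵀ := by
  rw [Hlow, H, Hfac, ← fromBlocks_toBlocks S.Φ, fromBlocks_transpose, fromBlocks_multiply,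
    fromBlocks_multiply]
  simp

theorem posDef_neg_Hlow (hΦ : (-S.Φ.toBlocks₂₂).PosDef)
    (hrank : S.regressor.rank = n + m + mw) : (-S.Hlow).PosDef := by
  have hrows : LinearIndependent ℝ S.regressor.row :=
    linearIndependent_row_of_rank_eq (by simp [hrank, add_assoc])
  simpa [Hlow_eq] using hΦ.mul_mul_conjTranspose_same (vecMul_injective_iff.2 hrows)

theorem Hlow_mul_checkT (h : IsUnit S.Hlow) : S.Hlow * S.checkT = -S.Htopᵀ := by
  rw [checkT, Matrix.mul_neg, mul_nonsing_inv_cancel_left _ _ ((isUnit_iff_isUnit_det _).1 h)]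

theorem HbarT_eq_zero (h : IsUnit S.Hlow) : S.HbarT = 0 := by
  rw [HbarT, checkCol, fromCols_mul_fromRows, Hlow_mul_checkT h]
  simp

theorem H_eq_fromBlocks (hΦ : S.Φ.IsSymm) (h : IsUnit S.Hlow) :
    S.H = fromBlocks S.H.toBlocks₁₁ (-(S.checkTᵀ * S.Hlow)) (-(S.checkTᵀ * S.Hlow))ᵀ S.Hlow := by
  have htop : -(S.checkTᵀ * S.Hlow) = S.Htop := by
    rw [← (isSymm_Hlow hΦ).eq, ← transpose_mul, Hlow_mul_checkT h, transpose_neg,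
      transpose_transpose, neg_neg]
  rw [htop]
  exact eq_fromBlocks_of_isSymm (isSymm_H hΦ)

theorem paramRow_mul_H_mul_transpose (hΦ : S.Φ.IsSymm) (h : IsUnit S.Hlow)
    (hfact : S.IsFactorization) (T : Matrix (Fin p) (Fin n ⊕ Fin m ⊕ Fin mw) ℝ) :
    paramRow T * S.H * (paramRow T)ᵀ =
      S.Ξ * S.Λ * S.Ξᵀ - (T - S.checkTᵀ) * (-S.Hlow) * (T - S.checkTᵀ)ᵀ := by
  have hcheck : S.checkCol = (paramRow S.checkTᵀ)ᵀ := by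
    rw [paramRow, transpose_fromCols, transpose_one, transpose_transpose, checkCol]
  rw [← hfact.2, hcheck, H_eq_fromBlocks hΦ h, transpose_transpose, Matrix.mul_neg, Matrix.neg_mul,
    sub_neg_eq_add]
  exact paramRow_mul_fromBlocks_mul_transpose (isSymm_Hlow hΦ) T S.checkTᵀ

theorem paramRow_mul_Hfac (T : Matrix (Fin p) (Fin n ⊕ Fin m ⊕ Fin mw) ℝ) :
    paramRow T * S.Hfac = fromCols S.Bd0 (S.Y - T * S.regressor) := by
  rw [Hfac, paramRow, fromCols_mul_fromBlocks]
  simp [sub_eq_add_neg]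

theorem mem_Sigma_iff (hBd0 : S.Bd0.rank = md) (hΦ : S.Φ.IsSymm)
    (hΦ22 : (-S.Φ.toBlocks₂₂).PosDef) (h : IsUnit S.Hlow) (hfact : S.IsFactorization)
    {As : Matrix (Fin p) (Fin n) ℝ} {Bu : Matrix (Fin p) (Fin m) ℝ}
    {Bw : Matrix (Fin p) (Fin mw) ℝ} {D : Matrix (Fin p) (Fin n ⊕ Fin m ⊕ Fin mw) ℝ}
    (hD : fromCols As (fromCols Bu Bw) = S.checkTᵀ + D) :
    (As, Bu, Bw) ∈ S.Sigma ↔ (S.Ξ * S.Λ * S.Ξᵀ - D * (-S.Hlow) * Dᵀ).PosSemidef := by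
  have hcols : LinearIndependent ℝ S.Bd0.col :=
    linearIndependent_col_of_rank_eq (by rw [hBd0, Fintype.card_fin])
  have hreg : fromCols As (fromCols Bu Bw) * S.regressor = As * S.Xd + Bu * S.U + Bw * S.W := by
    rw [regressor, fromCols_mul_fromRows, fromCols_mul_fromRows, add_assoc]
  have hqmi : S.Ξ * S.Λ * S.Ξᵀ - D * (-S.Hlow) * Dᵀ =
      fromCols S.Bd0 (S.Y - (As * S.Xd + Bu * S.U + Bw * S.W)) * S.Φ *
        (fromCols S.Bd0 (S.Y - (As * S.Xd + Bu * S.U + Bw * S.W)))ᵀ := by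
    have hsquare := paramRow_mul_H_mul_transpose hΦ h hfact (S.checkTᵀ + D)
    rw [add_sub_cancel_left] at hsquare
    rw [← hsquare, ← hD, ← hreg, ← paramRow_mul_Hfac, H, transpose_mul]
    simp only [Matrix.mul_assoc]
  rw [hqmi, ← exists_mul_eq_posSemidef_iff hΦ22 hcols]
  refine exists_congr fun W => and_congr ?_ ?_
  · rw [NoiseBound, noiseCol, transpose_fromRows, transpose_one, transpose_transpose, paramRow,
      transpose_fromCols, transpose_one]
  · exact eq_comm.trans eq_sub_iff_add_eq'.symm

theorem linearIndependent_row_Xs1 (hX : S.X = S.Xs * diagonal S.sv * S.Xrᵀ)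
    (hrows : LinearIndependent ℝ (fun i : Fin p => S.X (Sum.inl i))) :
    LinearIndependent ℝ S.Xs1.row := by
  have hXs1 : (S.Xs1 * S.Xd).row = fun i : Fin p => S.X (Sum.inl i) := by
    funext i
    rw [hX, Matrix.mul_assoc]
    rfl
  rw [← hXs1, ← vecMul_injective_iff] at hrows
  refine vecMul_injective_iff.1 (Function.Injective.of_comp (f := (· ᵥ* S.Xd)) ?_)
  simpa only [Function.comp_def, vecMul_vecMul] using hrows

theorem padL_eq (hXs1 : LinearIndependent ℝ S.Xs1.row)
    (hker : Submodule.span ℝ (Set.range S.L1.row) = LinearMap.ker S.Xs1.mulVecLin)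
    {b : Type} (M : Matrix b (Fin p) ℝ) : S.padL M = M * S.Xs1 := by
  have hL : rectInv S.L * (fromRows 0 1 : Matrix (Fin (n - p) ⊕ Fin p) (Fin p) ℝ) = S.Xs1ᵀ :=
    rectInv_fromRows_mul_fromRows_zero_one hXs1 hker
  rw [padL, LinvT, ← transpose_transpose S.Xs1, ← hL, transpose_mul, ← Matrix.mul_assoc,
    transpose_fromRows, mul_fromCols]
  simp

end Data

end Setup

section Perturbation

variable {X ι κ ν R : Type*} [TopologicalSpace X] [TopologicalSpace R]

theorem continuous_fromRows {f : X → Matrix ι ν R} {g : X → Matrix κ ν R} (hf : Continuous f)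
    (hg : Continuous g) : Continuous fun x => fromRows (f x) (g x) := by
  refine continuous_matrix fun i j => ?_
  cases i with
  | inl i => exact hf.matrix_elem i j
  | inr i => exact hg.matrix_elem i j

theorem continuous_fromCols {f : X → Matrix ν ι R} {g : X → Matrix ν κ R} (hf : Continuous f)
    (hg : Continuous g) : Continuous fun x => fromCols (f x) (g x) := by
  refine continuous_matrix fun i j => ?_
  cases j with
  | inl j => exact hf.matrix_elem i j
  | inr j => exact hg.matrix_elem i j

theorem frequently_isUnit_add_smul_one [Fintype ι] [DecidableEq ι] (V : Matrix ι ι ℝ) :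
    ∃ᶠ ε in nhds (0 : ℝ), IsUnit (V + ε • (1 : Matrix ι ι ℝ)) := by
  have hspectrum : ∀ᶠ ε in nhdsWithin (0 : ℝ) {0}ᶜ, ε ∉ spectrum ℝ (-V) := by
    have hfinite : (spectrum ℝ (-V) \ {0}).Finite := (Matrix.finite_spectrum (-V)).sdiff
    filter_upwards [nhdsWithin_le_nhds (hfinite.isClosed.isOpen_compl.mem_nhds (by simp)),
      self_mem_nhdsWithin] with ε hε hε0 hmem using hε ⟨hmem, hε0⟩
  refine (hspectrum.mono fun ε hε => ?_).frequently.filter_mono nhdsWithin_le_nhds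
  rwa [spectrum.notMem_iff, sub_neg_eq_add, Algebra.algebraMap_eq_smul_one, add_comm] at hε

theorem exists_isUnit_toBlocks₁₂_of_eventually [Fintype ι] [DecidableEq ι]
    {P : Matrix (ι ⊕ ι) (ι ⊕ ι) ℝ} (hP : P.IsSymm) {p : Matrix (ι ⊕ ι) (ι ⊕ ι) ℝ → Prop}
    (hp : ∀ᶠ P' in nhds P, P'.IsSymm → p P') : ∃ P', IsUnit P'.toBlocks₁₂ ∧ p P' := by
  let J : Matrix (ι ⊕ ι) (ι ⊕ ι) ℝ := fromBlocks 0 1 1 0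
  have hsymm (ε : ℝ) : (P + ε • J).IsSymm :=
    hP.add (.smul (isSymm_zero.fromBlocks transpose_one isSymm_zero) ε)
  have htendsto : Filter.Tendsto (fun ε : ℝ => P + ε • J) (nhds 0) (nhds P) := by
    have : Continuous fun ε : ℝ => P + ε • J := by fun_prop
    simpa using this.tendsto 0
  obtain ⟨ε, hunit, hε⟩ :=
    ((frequently_isUnit_add_smul_one P.toBlocks₁₂).and_eventually (htendsto.eventually hp)).exists
  refine ⟨P + ε • J, ?_, hε (hsymm ε)⟩
  convert hunit using 1
  ext i j
  simp [J, toBlocks₁₂]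

end Perturbation

namespace Setup

variable {k p m mw md N pz pc n q : ℕ} (S : Setup k p m mw md N pz pc n q)

section ClosedLoop

/-- The matrix through which a perturbation `D` of the parameters `(Ā_s B_{u0} B_{w0})` enters the
closed loop: `Ã` and `B̃` change by `uncIn * D * uncOut` and `uncIn * D * uncThrough`. -/
def uncIn : Matrix (Fin n ⊕ Fin n) (Fin p) ℝ := fromRows S.Xs1ᵀ 0

/-- The contribution of the closed-loop state to the signal `col(x, u, w)` on which a perturbation
of the parameters acts. -/
def uncOut (K : Controller m pc n) : Matrix (Fin n ⊕ Fin m ⊕ Fin mw) (Fin n ⊕ Fin n) ℝ :=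
  fromRows (fromCols 1 0) (fromRows (fromCols (K.Dc * S.C) K.Cc) 0)

/-- The contribution of the performance input to the signal `col(x, u, w)` on which a perturbation
of the parameters acts. -/
def uncThrough (n m mw : ℕ) : Matrix (Fin n ⊕ Fin m ⊕ Fin mw) (Fin mw) ℝ :=
  fromRows 0 (fromRows 0 1)

/-- The multiplier matrix that certifies the Lyapunov inequality of the closed loop for all triples
in `Σ`. -/
noncomputable def lyapunovMat (K : Controller m pc n)
    (P : Matrix (Fin n ⊕ Fin n) (Fin n ⊕ Fin n) ℝ) (α : ℝ) :
    Matrix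
      (((Fin n ⊕ Fin n) ⊕ Fin mw) ⊕ ((Fin n ⊕ Fin n) ⊕ ((Fin n ⊕ Fin m ⊕ Fin mw) ⊕ Fin q)))
      (((Fin n ⊕ Fin n) ⊕ Fin mw) ⊕ ((Fin n ⊕ Fin n) ⊕ ((Fin n ⊕ Fin m ⊕ Fin mw) ⊕ Fin q))) ℝ :=
  multiplierMat (fromBlocks P 0 0 1)
    (fromCols (S.clA K S.checkAs S.checkBu * P) (S.clB S.checkBw))
    (fromCols (S.uncOut K * P) (uncThrough n m mw)) P (S.uncIn * S.Ξ) (-S.Hlow) S.Λ α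

/-- The output inequality of the closed loop with the term `D̃ D̃ᵀ` resolved by a Schur
complement. -/
def outputMat (K : Controller m pc n) (P : Matrix (Fin n ⊕ Fin n) (Fin n ⊕ Fin n) ℝ)
    (Z : Matrix (Fin pz) (Fin pz) ℝ) :
    Matrix ((Fin mw ⊕ Fin pz) ⊕ (Fin n ⊕ Fin n)) ((Fin mw ⊕ Fin pz) ⊕ (Fin n ⊕ Fin n)) ℝ :=
  fromBlocks (fromBlocks 1 S.D1ᵀ S.D1 Z) (fromRows 0 (S.clC K * P)) (fromRows 0 (S.clC K * P))ᵀ P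

theorem checkT_transpose : S.checkTᵀ = fromCols S.checkAs (fromCols S.checkBu S.checkBw) := by
  rw [checkAs, checkBu, checkBw, ← transpose_fromRows, fromRows_toRows, ← transpose_fromRows,
    fromRows_toRows]

theorem Xs_transpose_mul_fromRows_add {κ : Type*} (M D : Matrix (Fin p) κ ℝ)
    (R : Matrix (RestIdx k p m mw) κ ℝ) :
    S.Xsᵀ * fromRows (M + D) R = S.Xsᵀ * fromRows M R + S.Xs1ᵀ * D := by
  rw [← fromRows_toRows S.Xs, Xs1, transpose_fromRows, fromCols_mul_fromRows,
    fromCols_mul_fromRows, Matrix.mul_add]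
  exact add_right_comm _ _ _

theorem clA_add (K : Controller m pc n) (As D₁ : Matrix (Fin p) (Fin n) ℝ)
    (Bu D₂ : Matrix (Fin p) (Fin m) ℝ) (D₃ : Matrix (Fin p) (Fin mw) ℝ) :
    S.clA K (As + D₁) (Bu + D₂) =
      S.clA K As Bu + S.uncIn * fromCols D₁ (fromCols D₂ D₃) * S.uncOut K := by
  have hA : S.A (As + D₁) = S.A As + S.Xs1ᵀ * D₁ := S.Xs_transpose_mul_fromRows_add As D₁ _
  have hB : S.B (Bu + D₂) = S.B Bu + S.Xs1ᵀ * D₂ := S.Xs_transpose_mul_fromRows_add Bu D₂ _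
  rw [clA, clA, hA, hB, Matrix.mul_assoc S.uncIn, uncOut, fromCols_mul_fromRows,
    fromCols_mul_fromRows, mul_fromCols, mul_fromCols, uncIn, fromRows_mul]
  ext (i | i) (j | j) <;>
    simp [Matrix.mul_add, Matrix.add_mul, Matrix.mul_assoc, add_add_add_comm]

theorem clB_add (D₁ : Matrix (Fin p) (Fin n) ℝ) (D₂ : Matrix (Fin p) (Fin m) ℝ)
    (Bw D₃ : Matrix (Fin p) (Fin mw) ℝ) :
    S.clB (Bw + D₃) =
      S.clB Bw + S.uncIn * fromCols D₁ (fromCols D₂ D₃) * uncThrough n m mw := by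
  have hB₁ : S.B1 (Bw + D₃) = S.B1 Bw + S.Xs1ᵀ * D₃ := S.Xs_transpose_mul_fromRows_add Bw D₃ _
  rw [clB, clB, hB₁, Matrix.mul_assoc, uncThrough, fromCols_mul_fromRows, fromCols_mul_fromRows,
    uncIn, fromRows_mul]
  ext (i | i) j <;> simp

theorem fromCols_clA_mul_clB (K : Controller m pc n)
    (P : Matrix (Fin n ⊕ Fin n) (Fin n ⊕ Fin n) ℝ) {As : Matrix (Fin p) (Fin n) ℝ}
    {Bu : Matrix (Fin p) (Fin m) ℝ} {Bw : Matrix (Fin p) (Fin mw) ℝ}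
    {D : Matrix (Fin p) (Fin n ⊕ Fin m ⊕ Fin mw) ℝ}
    (hD : fromCols As (fromCols Bu Bw) = S.checkTᵀ + D) :
    fromCols (S.clA K As Bu * P) (S.clB Bw) =
      fromCols (S.clA K S.checkAs S.checkBu * P) (S.clB S.checkBw) +
        S.uncIn * D * fromCols (S.uncOut K * P) (uncThrough n m mw) := by
  obtain ⟨D₁, D₂, D₃, rfl⟩ : ∃ D₁ D₂ D₃, D = fromCols D₁ (fromCols D₂ D₃) :=
    ⟨_, _, _, by rw [fromCols_toCols, fromCols_toCols]⟩
  have hadd : S.checkTᵀ + fromCols D₁ (fromCols D₂ D₃) =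
      fromCols (S.checkAs + D₁) (fromCols (S.checkBu + D₂) (S.checkBw + D₃)) := by
    rw [checkT_transpose]
    ext i (j | j | j) <;> rfl
  rw [hadd, fromCols_inj.eq_iff, fromCols_inj.eq_iff] at hD
  obtain ⟨rfl, rfl, rfl⟩ := hD
  rw [S.clA_add K _ D₁ _ D₂ D₃, S.clB_add D₁ D₂, Matrix.add_mul, Matrix.mul_assoc _ _ P,
    mul_fromCols _ (S.uncOut K * P)]
  ext i (j | j) <;> rfl

variable {S} {K : Controller m pc n} {P : Matrix (Fin n ⊕ Fin n) (Fin n ⊕ Fin n) ℝ}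
  {Z : Matrix (Fin pz) (Fin pz) ℝ} {α μ : ℝ}

theorem posDef_of_posDef_outputMat (h : (S.outputMat K P Z).PosDef) : P.PosDef :=
  h.submatrix Sum.inr_injective

theorem forall_mem_Sigma_posDef_lyapunov_iff (hBd0 : S.Bd0.rank = md) (hΦ : S.Φ.IsSymm)
    (hΦ22 : (-S.Φ.toBlocks₂₂).PosDef) (hH : (-S.Hlow).PosDef) (hfact : S.IsFactorization)
    (hP : P.PosDef) :
    (∀ As Bu Bw, (As, Bu, Bw) ∈ S.Sigma →
        (fromBlocks (1 : Matrix (Fin mw) (Fin mw) ℝ) (S.clB Bw)ᵀ (S.clB Bw)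
          (P - S.clA K As Bu * P * (S.clA K As Bu)ᵀ)).PosDef) ↔
      ∃ α, (S.lyapunovMat K P α).PosDef := by
  have hunit : IsUnit S.Hlow := by simpa using hH.isUnit.neg
  simp only [lyapunovMat, exists_posDef_multiplierMat_iff hH hfact.1, posDef_lyapunov_iff hP]
  constructor
  · intro h D hD
    obtain ⟨As, Bu, Bw, hT⟩ : ∃ As Bu Bw, fromCols As (fromCols Bu Bw) = S.checkTᵀ + D :=
      ⟨_, _, _, by rw [fromCols_toCols, fromCols_toCols]⟩
    rw [← S.fromCols_clA_mul_clB K P hT]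
    exact h As Bu Bw ((mem_Sigma_iff hBd0 hΦ hΦ22 hunit hfact hT).2 hD)
  · intro h As Bu Bw hmem
    have hT := (add_sub_cancel S.checkTᵀ (fromCols As (fromCols Bu Bw))).symm
    rw [S.fromCols_clA_mul_clB K P hT]
    exact h _ ((mem_Sigma_iff hBd0 hΦ hΦ22 hunit hfact hT).1 hmem)

theorem H2Robust_iff (hBd0 : S.Bd0.rank = md) (hΦ : S.Φ.IsSymm)
    (hΦ22 : (-S.Φ.toBlocks₂₂).PosDef) (hSigma : S.Sigma.Nonempty) (hH : (-S.Hlow).PosDef)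
    (hfact : S.IsFactorization) :
    S.H2Robust μ Z K P ↔
      Z.trace < μ ^ 2 ∧ (S.outputMat K P Z).PosDef ∧ ∃ α, (S.lyapunovMat K P α).PosDef := by
  have hlyap (hP : P.PosDef) :=
    forall_mem_Sigma_posDef_lyapunov_iff (K := K) hBd0 hΦ hΦ22 hH hfact hP
  constructor
  · intro h
    obtain ⟨⟨As, Bu, Bw⟩, hmem⟩ := hSigma
    obtain ⟨hZ, -, hout⟩ := h As Bu Bw hmem
    have hP : P.PosDef := hout.submatrix Sum.inr_injective
    exact ⟨hZ, (posDef_output_iff hP Z _ _).1 hout,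
      (hlyap hP).1 fun As Bu Bw hmem => (h As Bu Bw hmem).2.1⟩
  · rintro ⟨hZ, hout, hα⟩ As Bu Bw hmem
    have hP := posDef_of_posDef_outputMat hout
    exact ⟨hZ, (hlyap hP).2 hα As Bu Bw hmem, (posDef_output_iff hP Z _ _).2 hout⟩

theorem eventually_posDef_outputMat (h : (S.outputMat K P Z).PosDef) :
    ∀ᶠ P' in nhds P, P'.IsSymm → (S.outputMat K P' Z).PosDef := by
  have hC : Continuous fun P' : Matrix (Fin n ⊕ Fin n) (Fin n ⊕ Fin n) ℝ =>
      (fromRows 0 (S.clC K * P') : Matrix (Fin mw ⊕ Fin pz) (Fin n ⊕ Fin n) ℝ) :=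
    continuous_fromRows continuous_const (by fun_prop)
  have hcont : Continuous fun P' => S.outputMat K P' Z :=
    continuous_const.matrix_fromBlocks hC hC.matrix_transpose continuous_id
  have hsymm : (S.outputMat K P Z).IsSymm := by simpa using h.isHermitian
  obtain ⟨hZ, -, -, -⟩ := isSymm_fromBlocks_iff.1 hsymm
  filter_upwards [hcont.continuousAt.eventually (eventually_posDef h)] with P' hpos hP'
  exact hpos (hZ.fromBlocks rfl hP')

theorem eventually_posDef_lyapunovMat (h : (S.lyapunovMat K P α).PosDef) :
    ∀ᶠ P' in nhds P, P'.IsSymm → (S.lyapunovMat K P' α).PosDef := by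
  have hG : Continuous fun P' : Matrix (Fin n ⊕ Fin n) (Fin n ⊕ Fin n) ℝ =>
      (fromRows (fromCols (S.clA K S.checkAs S.checkBu * P') (S.clB S.checkBw))
        (fromRows (fromCols (S.uncOut K * P') (uncThrough n m mw)) 0) :
        Matrix ((Fin n ⊕ Fin n) ⊕ ((Fin n ⊕ Fin m ⊕ Fin mw) ⊕ Fin q)) _ ℝ) :=
    continuous_fromRows (continuous_fromCols (by fun_prop) continuous_const)
      (continuous_fromRows (continuous_fromCols (by fun_prop) continuous_const) continuous_const)
  have hcont : Continuous fun P' => S.lyapunovMat K P' α :=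
    (continuous_id.matrix_fromBlocks continuous_const continuous_const
      continuous_const).matrix_fromBlocks hG.matrix_transpose hG
      (continuous_id.matrix_fromBlocks continuous_const continuous_const continuous_const)
  have hsymm : (S.lyapunovMat K P α).IsSymm := by simpa using h.isHermitian
  obtain ⟨-, -, -, hright⟩ := isSymm_fromBlocks_iff.1 hsymm
  obtain ⟨-, -, -, hcorner⟩ := isSymm_fromBlocks_iff.1 hright
  filter_upwards [hcont.continuousAt.eventually (eventually_posDef h)] with P' hpos hP'
  exact hpos ((hP'.fromBlocks transpose_zero transpose_one).fromBlocks (transpose_transpose _)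
    (hP'.fromBlocks (transpose_transpose _) hcorner))

end ClosedLoop

end Setup

section LyapunovPartition

variable {ι R : Type*} [Fintype ι] [DecidableEq ι] [CommRing R]

/-- The congruence `(X I; Uᵀ 0)` behind the linearizing change of variables, where `(X U)` is the
upper block row of the inverse of the Lyapunov matrix. -/
def congrMat (X U : Matrix ι ι R) : Matrix (ι ⊕ ι) (ι ⊕ ι) R :=
  fromBlocks X 1 Uᵀ 0

/-- The blocks of a Lyapunov matrix `P = (Y V; Vᵀ ⋆)` and of its inverse `(X U; Uᵀ ⋆)`. Only the
relations used by the change of variables are recorded, so that `P` may be constructed from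
`X`, `Y`, `U` and `V`. -/
structure IsLyapunovPartition (P : Matrix (ι ⊕ ι) (ι ⊕ ι) R) (X Y U V : Matrix ι ι R) : Prop where
  isSymm : X.IsSymm
  isUnit : IsUnit U
  add_eq_one : X * Y + U * Vᵀ = 1
  mul_congrMat : P * congrMat X U = fromBlocks 1 Y 0 Vᵀ

theorem congrMat_mul_fromBlocks_swap (X U : Matrix ι ι R) :
    congrMat X U * fromBlocks 0 1 1 0 = fromBlocks 1 X 0 Uᵀ := by
  simp [congrMat, fromBlocks_multiply]

theorem isUnit_congrMat_iff {X U : Matrix ι ι R} : IsUnit (congrMat X U) ↔ IsUnit U := by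
  have hswap : IsUnit (fromBlocks 0 1 1 0 : Matrix (ι ⊕ ι) (ι ⊕ ι) R) :=
    .of_mul_eq_one (fromBlocks 0 1 1 0) (by simp [fromBlocks_multiply])
  rw [← hswap.mul_right_iff, congrMat_mul_fromBlocks_swap, isUnit_fromBlocks_zero₂₁,
    isUnit_transpose]
  simp

namespace IsLyapunovPartition

variable {P : Matrix (ι ⊕ ι) (ι ⊕ ι) R} {X Y U V : Matrix ι ι R}

theorem congrMat_transpose_mul_mul (h : IsLyapunovPartition P X Y U V) :
    (congrMat X U)ᵀ * P * congrMat X U = fromBlocks X 1 1 Y := by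
  rw [Matrix.mul_assoc, h.mul_congrMat, congrMat, fromBlocks_transpose, fromBlocks_multiply]
  simp [h.isSymm.eq, h.add_eq_one]

theorem mul_fromBlocks (h : IsLyapunovPartition P X Y U V) :
    P * fromBlocks 1 X 0 Uᵀ = fromBlocks Y 1 Vᵀ 0 := by
  rw [← congrMat_mul_fromBlocks_swap, ← Matrix.mul_assoc, h.mul_congrMat]
  simp [fromBlocks_multiply]

theorem fromBlocks_transpose_mul_mul (h : IsLyapunovPartition P X Y U V) :
    (fromBlocks 1 X 0 Uᵀ)ᵀ * P * fromBlocks 1 X 0 Uᵀ = fromBlocks Y 1 1 X := by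
  rw [Matrix.mul_assoc, h.mul_fromBlocks, fromBlocks_transpose, fromBlocks_multiply]
  simp [h.isSymm.eq, h.add_eq_one]

end IsLyapunovPartition

theorem isLyapunovPartition_toBlocks {P : Matrix (ι ⊕ ι) (ι ⊕ ι) R} (hP : P.IsSymm)
    (hunit : IsUnit P) (hV : IsUnit P.toBlocks₁₂) :
    IsLyapunovPartition P P⁻¹.toBlocks₁₁ P.toBlocks₁₁ P⁻¹.toBlocks₁₂ P.toBlocks₁₂ := by
  have hdet : IsUnit P.det := (isUnit_iff_isUnit_det P).1 hunit
  have hQ : P⁻¹.IsSymm := by rw [IsSymm, transpose_nonsing_inv, hP.eq]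
  have hQP : fromBlocks P⁻¹.toBlocks₁₁ P⁻¹.toBlocks₁₂ P⁻¹.toBlocks₁₂ᵀ P⁻¹.toBlocks₂₂ *
      fromBlocks P.toBlocks₁₁ P.toBlocks₁₂ P.toBlocks₁₂ᵀ P.toBlocks₂₂ = fromBlocks 1 0 0 1 := by
    rw [← eq_fromBlocks_of_isSymm hP, ← eq_fromBlocks_of_isSymm hQ, nonsing_inv_mul P hdet,
      fromBlocks_one]
  obtain ⟨h₁₁, -, h₂₁, -⟩ := fromBlocks_inj.1 ((fromBlocks_multiply ..).symm.trans hQP)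
  have hcongr : P⁻¹ * fromBlocks 1 P.toBlocks₁₁ 0 P.toBlocks₁₂ᵀ =
      congrMat P⁻¹.toBlocks₁₁ P⁻¹.toBlocks₁₂ := by
    conv_lhs => rw [eq_fromBlocks_of_isSymm hQ, fromBlocks_multiply, h₁₁, h₂₁]
    simp [congrMat]
  refine ⟨hQ.submatrix Sum.inl, ?_, h₁₁, ?_⟩
  · rw [← isUnit_congrMat_iff, ← hcongr]
    refine (isUnit_nonsing_inv_iff.2 hunit).mul (isUnit_fromBlocks_zero₂₁.2 ⟨isUnit_one, ?_⟩)
    exact (isUnit_transpose _).2 hV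
  · rw [← hcongr, mul_nonsing_inv_cancel_left P _ hdet]

theorem isLyapunovPartition_of_add_eq_one {X Y U V : Matrix ι ι R} (hX : X.IsSymm)
    (hU : IsUnit U) (h : X * Y + U * Vᵀ = 1) :
    IsLyapunovPartition (fromBlocks 1 Y 0 Vᵀ * (congrMat X U)⁻¹) X Y U V :=
  ⟨hX, hU, h, nonsing_inv_mul_cancel_right _ _
    ((isUnit_iff_isUnit_det _).1 (isUnit_congrMat_iff.2 hU))⟩

theorem isUnit_one_sub_mul_of_posDef {X Y : Matrix ι ι ℝ} (h : (fromBlocks X 1 1 Y).PosDef) :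
    IsUnit (1 - X * Y) := by
  have hY : Y.PosDef := h.submatrix Sum.inr_injective
  have := hY.isUnit.invertible
  have hschur := isUnit_fromBlocks_iff_of_invertible₂₂.1 h.isUnit
  convert (hschur.mul hY.isUnit).neg using 1
  simp [Matrix.sub_mul]

end LyapunovPartition

section MultiplierCongruence

theorem posDef_transpose_mul_mul_iff {ι : Type*} [Fintype ι] [DecidableEq ι] {Q T : Matrix ι ι ℝ}
    (hT : IsUnit T) : (Tᵀ * Q * T).PosDef ↔ Q.PosDef :=
  hT.posDef_star_left_conjugate_iff

variable {a b r q : Type*} [Fintype a] [Fintype b] [Fintype q] [DecidableEq q]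

theorem transpose_mul_multiplierMat_mul [Fintype r] [DecidableEq r] (S : Matrix a a ℝ)
    (G : Matrix b a ℝ) (M : Matrix r a ℝ) (P : Matrix b b ℝ) (F : Matrix b q ℝ)
    (Γ : Matrix r r ℝ) (Λ : Matrix q q ℝ) (α : ℝ) (T₁ : Matrix a a ℝ) (T₂ : Matrix b b ℝ) :
    (fromBlocks T₁ 0 0 (fromBlocks T₂ 0 0 (1 : Matrix (r ⊕ q) (r ⊕ q) ℝ)))ᵀ *
        multiplierMat S G M P F Γ Λ α *
        fromBlocks T₁ 0 0 (fromBlocks T₂ 0 0 (1 : Matrix (r ⊕ q) (r ⊕ q) ℝ)) =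
      multiplierMat (T₁ᵀ * S * T₁) (T₂ᵀ * G * T₁) (M * T₁) (T₂ᵀ * P * T₂) (T₂ᵀ * F) Γ Λ α := by
  simp only [multiplierMat, fromBlocks_transpose, fromBlocks_multiply, transpose_zero,
    transpose_one, Matrix.zero_mul, Matrix.mul_zero, add_zero, zero_add, Matrix.one_mul,
    Matrix.mul_one, transpose_fromRows, fromBlocks_mul_fromRows, fromRows_mul,
    mul_fromCols, fromCols_mul_fromBlocks, transpose_mul, transpose_smul, transpose_transpose,
    Matrix.smul_mul, Matrix.mul_smul, Matrix.mul_assoc]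

theorem posDef_multiplierMat_congr_iff [DecidableEq a] [DecidableEq b] [Finite r]
    {S : Matrix a a ℝ} {G : Matrix b a ℝ} {M : Matrix r a ℝ} {P : Matrix b b ℝ} {F : Matrix b q ℝ}
    {Γ : Matrix r r ℝ} {Λ : Matrix q q ℝ} {α : ℝ} {T₁ : Matrix a a ℝ} {T₂ : Matrix b b ℝ}
    (hT₁ : IsUnit T₁) (hT₂ : IsUnit T₂) :
    (multiplierMat (T₁ᵀ * S * T₁) (T₂ᵀ * G * T₁) (M * T₁) (T₂ᵀ * P * T₂) (T₂ᵀ * F) Γ Λ α).PosDef ↔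
      (multiplierMat S G M P F Γ Λ α).PosDef := by
  classical
  cases nonempty_fintype r
  rw [← transpose_mul_multiplierMat_mul]
  refine posDef_transpose_mul_mul_iff ?_
  simp only [isUnit_fromBlocks_zero₂₁, hT₁, hT₂, isUnit_one, and_self]

end MultiplierCongruence

namespace Setup

section Linearization

variable {k p m mw md N pz pc n q : ℕ} {S : Setup k p m mw md N pz pc n q}
  {v : DecisionVars m pc n} {K : Controller m pc n}
  {P : Matrix (Fin n ⊕ Fin n) (Fin n ⊕ Fin n) ℝ} {U V : Matrix (Fin n) (Fin n) ℝ}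

variable (S v K P U V) in
/-- The linearizing change of variables between a controller with Lyapunov matrix `P` and the
decision variables of the synthesis inequalities. -/
structure IsLinearization : Prop extends IsLyapunovPartition P v.Xb v.Yb U V where
  Dc_eq : v.Dc = K.Dc
  Ct_eq : v.Ct = K.Dc * S.C * v.Yb + K.Cc * Vᵀ
  Bt_eq : v.Bt = v.Xb * S.checkB * K.Dc + U * K.Bc
  At_eq : v.At = v.Xb * (S.checkA * v.Yb + S.checkB * v.Ct) + U * K.Bc * S.C * v.Yb
    + U * K.Ac * Vᵀ

theorem Pi22low_eq (hXs1 : LinearIndependent ℝ S.Xs1.row) (hker : S.IsKernelBasis)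
    (hH : IsUnit S.Hlow) (hXb : v.Xb.IsSymm) :
    S.Pi22low v =
      fromRows 0 (v.α • (fromRows (S.Xs1ᵀ * S.Ξ) (v.Xb * (S.Xs1ᵀ * S.Ξ)))ᵀ) := by
  rw [Pi22low, padL_eq hXs1 hker.2, padL_eq hXs1 hker.2, HbarT_eq_zero hH]
  simp only [smul_zero, neg_zero, Matrix.zero_mul, fromCols_zero, transpose_fromRows,
    transpose_mul, transpose_transpose, hXb.eq, Matrix.smul_mul]
  congr 1
  ext i (j | j) <;> simp

theorem PiMat_eq (hXs1 : LinearIndependent ℝ S.Xs1.row) (hker : S.IsKernelBasis)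
    (hH : IsUnit S.Hlow) (hXb : v.Xb.IsSymm) :
    S.PiMat v = multiplierMat (Pi11 v)
      (fromCols
        (fromBlocks
          (S.checkA + S.checkB * v.Dc * S.C) (S.checkA * v.Yb + S.checkB * v.Ct)
          (v.Xb * S.checkA + v.Bt * S.C) v.At)
        (fromRows S.checkB1 (v.Xb * S.checkB1)))
      (fromRows (fromCols (fromCols 1 v.Yb) 0)
        (fromRows (fromCols (fromCols (v.Dc * S.C) v.Ct) 0) (fromCols 0 1)))
      (fromBlocks v.Yb 1 1 v.Xb)
      (fromRows (S.Xs1ᵀ * S.Ξ) (v.Xb * (S.Xs1ᵀ * S.Ξ))) (-S.Hlow) S.Λ v.α := by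
  rw [PiMat, Pi22, Pi22low_eq hXs1 hker hH hXb, multiplierMat, smul_neg]
  rfl

theorem fromBlocks_transpose_mul_clB {X : Matrix (Fin n) (Fin n) ℝ} (hX : X.IsSymm) :
    (fromBlocks 1 X 0 Uᵀ)ᵀ * S.clB S.checkBw = fromRows S.checkB1 (X * S.checkB1) := by
  rw [clB, fromBlocks_transpose, fromBlocks_mul_fromRows]
  simp [hX.eq, checkB1]

theorem fromBlocks_transpose_mul_uncIn_mul {X : Matrix (Fin n) (Fin n) ℝ} (hX : X.IsSymm) :
    (fromBlocks 1 X 0 Uᵀ)ᵀ * (S.uncIn * S.Ξ) =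
      fromRows (S.Xs1ᵀ * S.Ξ) (X * (S.Xs1ᵀ * S.Ξ)) := by
  rw [uncIn, fromRows_mul, fromBlocks_transpose, fromBlocks_mul_fromRows]
  simp [hX.eq]

namespace IsLinearization

theorem mul_clA_mul_congrMat (h : IsLinearization S v K P U V) :
    (fromBlocks 1 v.Xb 0 Uᵀ)ᵀ * (S.clA K S.checkAs S.checkBu * P) * congrMat v.Xb U =
      fromBlocks
        (S.checkA + S.checkB * v.Dc * S.C) (S.checkA * v.Yb + S.checkB * v.Ct)
        (v.Xb * S.checkA + v.Bt * S.C) v.At := by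
  rw [← Matrix.mul_assoc, Matrix.mul_assoc _ P, h.mul_congrMat, clA, fromBlocks_transpose,
    fromBlocks_multiply, fromBlocks_multiply, h.At_eq, h.Bt_eq, h.Ct_eq, h.Dc_eq, h.isSymm.eq]
  simp only [checkA, checkB, transpose_zero, transpose_one, transpose_transpose,
    Matrix.zero_mul, Matrix.mul_zero, Matrix.one_mul, Matrix.mul_one, add_zero,
    Matrix.mul_add, Matrix.add_mul, Matrix.mul_assoc]
  congr 1 <;> abel

theorem uncOut_mul_mul_congrMat (h : IsLinearization S v K P U V) :
    S.uncOut K * P * congrMat v.Xb U =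
      fromRows (fromCols 1 v.Yb) (fromRows (fromCols (v.Dc * S.C) v.Ct) 0) := by
  rw [Matrix.mul_assoc, h.mul_congrMat, uncOut, fromRows_mul, fromRows_mul,
    fromCols_mul_fromBlocks, fromCols_mul_fromBlocks, h.Dc_eq, h.Ct_eq]
  simp

theorem clC_mul_mul_congrMat (h : IsLinearization S v K P U V) :
    S.clC K * P * congrMat v.Xb U =
      fromCols (S.C1 + S.E * v.Dc * S.C) (S.C1 * v.Yb + S.E * v.Ct) := by
  rw [Matrix.mul_assoc, h.mul_congrMat, clC, fromCols_mul_fromBlocks, h.Dc_eq, h.Ct_eq]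
  simp [Matrix.mul_add, Matrix.add_mul, Matrix.mul_assoc, add_assoc]

theorem posDef_PiMat_iff (h : IsLinearization S v K P U V)
    (hXs1 : LinearIndependent ℝ S.Xs1.row) (hker : S.IsKernelBasis) (hH : IsUnit S.Hlow) :
    (S.PiMat v).PosDef ↔ (S.lyapunovMat K P v.α).PosDef := by
  have hT₁ : IsUnit (fromBlocks (congrMat v.Xb U) 0 0 (1 : Matrix (Fin mw) (Fin mw) ℝ)) := by
    simp only [isUnit_fromBlocks_zero₂₁, isUnit_congrMat_iff, h.isUnit, isUnit_one, and_self]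
  have hT₂ : IsUnit (fromBlocks (1 : Matrix (Fin n) (Fin n) ℝ) v.Xb 0 Uᵀ) := by
    simp only [isUnit_fromBlocks_zero₂₁, isUnit_transpose, h.isUnit, isUnit_one, and_self]
  rw [lyapunovMat, ← posDef_multiplierMat_congr_iff hT₁ hT₂, PiMat_eq hXs1 hker hH h.isSymm,
    h.fromBlocks_transpose_mul_mul, fromBlocks_transpose_mul_uncIn_mul h.isSymm]
  congr! 2
  · simp [Pi11, fromBlocks_transpose, fromBlocks_multiply, h.congrMat_transpose_mul_mul]
  · rw [mul_fromCols, fromCols_mul_fromBlocks]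
    simp [h.mul_clA_mul_congrMat, fromBlocks_transpose_mul_clB h.isSymm]
  · rw [fromCols_mul_fromBlocks, h.uncOut_mul_mul_congrMat, uncThrough]
    ext (i | i | i) ((j | j) | j) <;> simp

theorem posDef_DeltaMat_iff (h : IsLinearization S v K P U V) (Z : Matrix (Fin pz) (Fin pz) ℝ) :
    (S.DeltaMat v Z).PosDef ↔ (S.outputMat K P Z).PosDef := by
  have hT : IsUnit
      (fromBlocks (1 : Matrix (Fin mw ⊕ Fin pz) (Fin mw ⊕ Fin pz) ℝ) 0 0 (congrMat v.Xb U)) := by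
    simp only [isUnit_fromBlocks_zero₂₁, isUnit_congrMat_iff, h.isUnit, isUnit_one, and_self]
  rw [← posDef_transpose_mul_mul_iff (Q := S.outputMat K P Z) hT, DeltaMat, outputMat,
    ← h.congrMat_transpose_mul_mul, ← h.clC_mul_mul_congrMat]
  simp [fromBlocks_transpose, fromBlocks_multiply, fromRows_mul, transpose_fromRows,
    Matrix.mul_assoc, mul_fromCols]

end IsLinearization

theorem exists_isLinearization (hP : P.PosDef) (hV : IsUnit P.toBlocks₁₂)
    (K : Controller m pc n) (α : ℝ) :
    ∃ (v : DecisionVars m pc n) (U : Matrix (Fin n) (Fin n) ℝ),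
      IsLinearization S v K P U P.toBlocks₁₂ ∧ v.Yb.IsSymm ∧ v.α = α := by
  have hsymm : P.IsSymm := by simpa using hP.isHermitian
  let Ct := K.Dc * S.C * P.toBlocks₁₁ + K.Cc * P.toBlocks₁₂ᵀ
  let Bt := P⁻¹.toBlocks₁₁ * S.checkB * K.Dc + P⁻¹.toBlocks₁₂ * K.Bc
  let At := P⁻¹.toBlocks₁₁ * (S.checkA * P.toBlocks₁₁ + S.checkB * Ct)
    + P⁻¹.toBlocks₁₂ * K.Bc * S.C * P.toBlocks₁₁ + P⁻¹.toBlocks₁₂ * K.Ac * P.toBlocks₁₂ᵀ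
  exact ⟨⟨α, P⁻¹.toBlocks₁₁, P.toBlocks₁₁, At, Bt, Ct, K.Dc⟩, P⁻¹.toBlocks₁₂,
    ⟨isLyapunovPartition_toBlocks hsymm hP.isUnit hV, rfl, rfl, rfl, rfl⟩,
    hsymm.submatrix Sum.inl, rfl⟩

theorem isUnit_recU {Z : Matrix (Fin pz) (Fin pz) ℝ} (hΔ : (S.DeltaMat v Z).PosDef)
    (hV : IsUnit V) : IsUnit (recU v V) :=
  (isUnit_one_sub_mul_of_posDef (hΔ.submatrix Sum.inr_injective)).mul
    (isUnit_nonsing_inv_iff.2 ((isUnit_transpose V).2 hV))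

theorem exists_isLinearization_reconstruct (hXb : v.Xb.IsSymm) (hV : IsUnit V)
    (hU : IsUnit (recU v V)) :
    ∃ P, IsLinearization S v (S.reconstruct v V) P (recU v V) V := by
  have hVdet : IsUnit Vᵀ.det := (isUnit_iff_isUnit_det _).1 ((isUnit_transpose V).2 hV)
  have hUdet : IsUnit (recU v V).det := (isUnit_iff_isUnit_det _).1 hU
  have hUV : v.Xb * v.Yb + recU v V * Vᵀ = 1 := by
    rw [recU, nonsing_inv_mul_cancel_right _ _ hVdet, add_sub_cancel]
  refine ⟨_, isLyapunovPartition_of_add_eq_one hXb hU hUV, rfl, ?_, ?_, ?_⟩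
  · simp only [reconstruct]
    rw [nonsing_inv_mul_cancel_right _ _ hVdet, add_sub_cancel]
  · simp only [reconstruct, recB]
    rw [mul_nonsing_inv_cancel_left _ _ hUdet, add_sub_cancel]
  · simp only [reconstruct]
    rw [← Matrix.mul_assoc, nonsing_inv_mul_cancel_right _ _ hVdet,
      mul_nonsing_inv_cancel_left _ _ hUdet]
    abel

end Linearization

section Synthesis

variable {k p m mw md N pz pc n q : ℕ} {S : Setup k p m mw md N pz pc n q} {μ : ℝ}
  {Z : Matrix (Fin pz) (Fin pz) ℝ}

theorem exists_synthesisLMI_of_H2Robust (hBd0 : S.Bd0.rank = md) (hΦ : S.Φ.IsSymm)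
    (hΦ22 : (-S.Φ.toBlocks₂₂).PosDef) (hSigma : S.Sigma.Nonempty) (hH : (-S.Hlow).PosDef)
    (hfact : S.IsFactorization) (hXs1 : LinearIndependent ℝ S.Xs1.row) (hker : S.IsKernelBasis)
    {K : Controller m pc n} {P : Matrix (Fin n ⊕ Fin n) (Fin n ⊕ Fin n) ℝ}
    (h : S.H2Robust μ Z K P) : ∃ v : DecisionVars m pc n, S.SynthesisLMI v μ Z := by
  obtain ⟨hZ, hout, α, hlyap⟩ := (H2Robust_iff hBd0 hΦ hΦ22 hSigma hH hfact).1 h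
  have hPsymm : P.IsSymm := by simpa using (posDef_of_posDef_outputMat hout).isHermitian
  have hopen : ∀ᶠ P' in nhds P, P'.IsSymm →
      (S.outputMat K P' Z).PosDef ∧ (S.lyapunovMat K P' α).PosDef := by
    filter_upwards [eventually_posDef_outputMat hout, eventually_posDef_lyapunovMat hlyap]
      with P' hout' hlyap' hP'
    exact ⟨hout' hP', hlyap' hP'⟩
  obtain ⟨P', hV, hout', hlyap'⟩ := exists_isUnit_toBlocks₁₂_of_eventually hPsymm hopen
  obtain ⟨v, U, hv, hYb, rfl⟩ :=
    exists_isLinearization (S := S) (posDef_of_posDef_outputMat hout') hV K α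
  have hHunit : IsUnit S.Hlow := by simpa using hH.isUnit.neg
  exact ⟨v, hv.isSymm, hYb, hZ, (hv.posDef_PiMat_iff hXs1 hker hHunit).2 hlyap',
    (hv.posDef_DeltaMat_iff Z).2 hout'⟩

theorem SynthesisLMI.exists_H2Robust_reconstruct (hBd0 : S.Bd0.rank = md) (hΦ : S.Φ.IsSymm)
    (hΦ22 : (-S.Φ.toBlocks₂₂).PosDef) (hSigma : S.Sigma.Nonempty) (hH : (-S.Hlow).PosDef)
    (hfact : S.IsFactorization) (hXs1 : LinearIndependent ℝ S.Xs1.row) (hker : S.IsKernelBasis)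
    {v : DecisionVars m pc n} (hv : S.SynthesisLMI v μ Z) {V : Matrix (Fin n) (Fin n) ℝ}
    (hV : IsUnit V) :
    IsUnit (recU v V) ∧ ∃ P, S.H2Robust μ Z (S.reconstruct v V) P := by
  obtain ⟨hXb, -, hZ, hPi, hΔ⟩ := hv
  have hU := isUnit_recU hΔ hV
  obtain ⟨P, hlin⟩ := exists_isLinearization_reconstruct (S := S) hXb hV hU
  have hHunit : IsUnit S.Hlow := by simpa using hH.isUnit.neg
  exact ⟨hU, P, (H2Robust_iff hBd0 hΦ hΦ22 hSigma hH hfact).2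
    ⟨hZ, (hlin.posDef_DeltaMat_iff Z).1 hΔ, v.α, (hlin.posDef_PiMat_iff hXs1 hker hHunit).1 hPi⟩⟩

end Synthesis

end Setup

end DataDrivenH2

open DataDrivenH2 in
theorem theorem2 {k p m mw md N pz pc n q : ℕ} (S : Setup k p m mw md N pz pc n q)
    (hBd0 : S.Bd0.rank = md)
    (hΦ : S.Φ.IsSymm) (hΦ22 : (-S.Φ.toBlocks₂₂).PosDef)
    (hSVD : S.IsCompactSVD)
    (hrows : LinearIndependent ℝ (fun i : Fin p => S.X (Sum.inl i)))
    (hSigma : S.Sigma.Nonempty)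
    (hrank : S.regressor.rank = n + m + mw)
    (hfact : S.IsFactorization)
    (hker : S.IsKernelBasis)
    (μ : ℝ) (Z : Matrix (Fin pz) (Fin pz) ℝ) :
    ((∃ (K : Controller m pc n) (P : Matrix (Fin n ⊕ Fin n) (Fin n ⊕ Fin n) ℝ),
        S.H2Robust μ Z K P) ↔
      ∃ v : DecisionVars m pc n, S.SynthesisLMI v μ Z) ∧
    (∀ v : DecisionVars m pc n, S.SynthesisLMI v μ Z →
      ∀ V : Matrix (Fin n) (Fin n) ℝ, V.rank = n →
        (Setup.recU v V).rank = n ∧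
        ∃ P : Matrix (Fin n ⊕ Fin n) (Fin n ⊕ Fin n) ℝ,
          S.H2Robust μ Z (S.reconstruct v V) P) := by
  have hH := Setup.posDef_neg_Hlow hΦ22 hrank
  have hXs1 := Setup.linearIndependent_row_Xs1 hSVD.1 hrows
  have hrec (v : DecisionVars m pc n) (hv : S.SynthesisLMI v μ Z) (V : Matrix (Fin n) (Fin n) ℝ)
      (hV : IsUnit V) :=
    hv.exists_H2Robust_reconstruct hBd0 hΦ hΦ22 hSigma hH hfact hXs1 hker hV
  refine ⟨⟨?_, ?_⟩, fun v hv V hV => ?_⟩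
  · rintro ⟨K, P, hKP⟩
    exact Setup.exists_synthesisLMI_of_H2Robust hBd0 hΦ hΦ22 hSigma hH hfact hXs1 hker hKP
  · rintro ⟨v, hv⟩
    exact ⟨S.reconstruct v 1, (hrec v hv 1 isUnit_one).2⟩
  · obtain ⟨hU, hP⟩ := hrec v hv V (isUnit_of_rank_eq (by rw [hV, Fintype.card_fin]))
    exact ⟨by rw [rank_of_isUnit _ hU, Fintype.card_fin], hP⟩
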